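/- Let $1\le n\le d$ be integers, let $A:\mathbb{R}^d\to\mathbb{R}^d$ and $B:\mathbb{R}^n\to\mathbb{R}^d$ be linear maps, and let $F:\mathbb{R}^d\to\mathbb{R}^d$ be smooth and globally Lipschitz. Let $d_*$ be an integer with $1\le d_*\le d$ (for instance, if the vectors $A^kBe_i$, $k\ge 0$, $1\le i\le n$, span $\mathbb{R}^d$, any such $d_*$ for which those with $k\le d_*-1$ already span). Assume: (D) every complex eigenvalue of $A$ has strictly negative real part; (G) there is $a\in[0,\tfrac{1}{2d_*})$ with $\sup_{x\in\mathbb{R}^d}|F(x)|/(1+|x|)^a<\infty$. Then for every $x\in\mathbb{R}^d$ the integral $V(x)=\int_0^\infty|e^{sA}x|^2\,\mathrm{d}s$ converges, and there is a positive definite matrix $M$ with $V(x)=\langle x,Mx\rangle$ for all $x$. Moreover, there exist constants $K>0$ and $\gamma\in(0,1)$ with the following property. Let $(W_t)_{t\ge0}$ be any Wiener process in $\mathbb{R}^n$ on a probability space, let $x\in\mathbb{R}^d$, and let $(X_t)_{t\ge0}$ be a continuous process satisfying almost surely $$X_t=x+\int_0^t\bigl(AX_s+F(X_s)\bigr)\,\mathrm{d}s+BW_t\qquad\text{for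 all } t\ge0 .$$ Let $P^F_t(x,\cdot)$ denote the law of $X_t$. Then for all $t\ge0$ the function $V$ is $P^F_t(x,\cdot)$-integrable and $$\Bigl|\int_{\mathbb{R}^d}V(y)\,P^F_t(x,\mathrm{d}y)\Bigr|\le\gamma^tV(x)+K .$$ -/

import Mathlib

open MeasureTheory ProbabilityTheory
open scoped NNReal

noncomputable section

/-- Condition (D): every eigenvalue of `A`, acting on the complexification of `ℝ^d`, has strictly
negative real part. -/
def Dissipative {d : ℕ} (A : EuclideanSpace ℝ (Fin d) →L[ℝ] EuclideanSpace ℝ (Fin d)) : Prop :=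
  ∀ z : ℂ, Module.End.HasEigenvalue
    (LinearMap.baseChange ℂ (A : EuclideanSpace ℝ (Fin d) →ₗ[ℝ] EuclideanSpace ℝ (Fin d))) z →
    z.re < 0

/-- Condition (G): for some `a ∈ [0, 1/(2 d_*))`, the function `|F(x)| / (1 + |x|)^a` is bounded
on `ℝ^d`. -/
def GrowthCondition {d : ℕ} (dstar : ℕ)
    (F : EuclideanSpace ℝ (Fin d) → EuclideanSpace ℝ (Fin d)) : Prop :=
  ∃ a : ℝ, 0 ≤ a ∧ a < 1 / (2 * (dstar : ℝ)) ∧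
    BddAbove (Set.range fun x : EuclideanSpace ℝ (Fin d) => ‖F x‖ / (1 + ‖x‖) ^ a)

/-- `V(x) = ∫_0^∞ |e^{sA} x|^2 ds`. -/
def lyapunovV {d : ℕ} (A : EuclideanSpace ℝ (Fin d) →L[ℝ] EuclideanSpace ℝ (Fin d))
    (x : EuclideanSpace ℝ (Fin d)) : ℝ :=
  ∫ s in Set.Ioi (0 : ℝ), ‖(NormedSpace.exp (s • A)) x‖ ^ 2

/-- Standard Wiener process in `ℝ^n`: it starts at `0`, has independent increments, the increment
over `[s, t]` has law `N(0, (t - s) I)`, and the paths are continuous (almost surely). -/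
structure IsWienerProcess {n : ℕ} {Ω : Type*} [MeasurableSpace Ω]
    (W : ℝ≥0 → Ω → EuclideanSpace ℝ (Fin n)) (P : Measure Ω) : Prop where
  zero : ∀ᵐ ω ∂P, W 0 ω = 0
  indep : HasIndepIncrements W P
  law : ∀ s t : ℝ≥0, s ≤ t →
    HasLaw (W t - W s)
      (multivariateGaussian 0 (((t : ℝ) - s) • (1 : Matrix (Fin n) (Fin n) ℝ))) P
  cont : ∀ᵐ ω ∂P, Continuous fun t => W t ω

/-- `X` is a continuous process which solves
`X_t = x + ∫_0^t (A X_s + F(X_s)) ds + B W_t` for all `t ≥ 0`, almost surely. -/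
structure IsSDESolution {d n : ℕ} {Ω : Type*} [MeasurableSpace Ω]
    (A : EuclideanSpace ℝ (Fin d) →L[ℝ] EuclideanSpace ℝ (Fin d))
    (F : EuclideanSpace ℝ (Fin d) → EuclideanSpace ℝ (Fin d))
    (B : EuclideanSpace ℝ (Fin n) →L[ℝ] EuclideanSpace ℝ (Fin d))
    (P : Measure Ω) (W : ℝ≥0 → Ω → EuclideanSpace ℝ (Fin n))
    (x : EuclideanSpace ℝ (Fin d)) (X : ℝ≥0 → Ω → EuclideanSpace ℝ (Fin d)) : Prop where
  aemeasurable : ∀ t, AEMeasurable (X t) P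
  cont : ∀ᵐ ω ∂P, Continuous fun t => X t ω
  eqn : ∀ᵐ ω ∂P, ∀ t : ℝ≥0,
    X t ω = x + (∫ s in (0 : ℝ)..t, (A (X s.toNNReal ω) + F (X s.toNNReal ω))) + B (W t ω)

end

/-!
If `A` is exponentially stable, then `V(x) = ⟨x, T x⟩`, where the Gramian
`T = ∫_0^∞ (e^{sA})^* e^{sA} ds` solves the Lyapunov equation `A^* T + T A = -1`; the latter also
makes `V` coercive.

Let `z` be the Ornstein–Uhlenbeck process with `dz = A z dt + B dW`, `z_0 = 0`, whose second moments
are bounded uniformly in time. Path by path, `y = X - z` solves `y' = A y + F(X)` with `y_0 = x`,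
and sublinear growth gives `|F(v)|² ≤ K_ε + ε |v|²` for every `ε > 0`. The estimate
`V(X) ≤ 2 V(y) + 2 V(z)` would leave a factor `2` in front of `V(x)`. Instead write
`y_t = e^{tA} x + r_t` and expand: the cross term `2 ⟨e^{tA} x, T z_t⟩` has mean zero, while
`r_t` is driven by `F(X)` only, so that `V(r_t)` costs at most a small multiple of
`t e^{-ct} V(x)` plus a constant. Hence the coefficient of `V(x)` stays below `e^{-ct/2}`.
-/

open Filter Topology Set

section ExpStable

variable {R : Type*} [NormedRing R] [NormedAlgebra ℝ R]

/-- `a` is exponentially stable when the semigroup `e^{ta}` decays exponentially as `t → ∞`. -/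
def ExpStable (a : R) : Prop :=
  ∃ C c : ℝ, 0 < c ∧ ∀ t : ℝ, 0 ≤ t → ‖NormedSpace.exp (t • a)‖ ≤ C * Real.exp (-(c * t))

variable [CompleteSpace R]

theorem exp_add_smul (a : R) (s t : ℝ) :
    NormedSpace.exp ((s + t) • a) = NormedSpace.exp (s • a) * NormedSpace.exp (t • a) := by
  let := NormedAlgebra.restrictScalars ℚ ℝ R
  rw [add_smul, NormedSpace.exp_add_of_commute (((Commute.refl a).smul_left s).smul_right t)]

@[fun_prop]
theorem continuous_exp_smul (a : R) : Continuous fun t : ℝ => NormedSpace.exp (t • a) :=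
  continuous_iff_continuousAt.2 fun t => (hasDerivAt_exp_smul_const a t).continuousAt

theorem exp_add_nat_mul_smul (a : R) (r : ℝ) (N k : ℕ) :
    NormedSpace.exp ((r + k * N) • a) =
      NormedSpace.exp (r • a) * (NormedSpace.exp a ^ N) ^ k := by
  let := NormedAlgebra.restrictScalars ℚ ℝ R
  rw [exp_add_smul, ← pow_mul, ← NormedSpace.exp_nsmul, ← Nat.cast_smul_eq_nsmul ℝ, Nat.cast_mul,
    mul_comm (k : ℝ)]

theorem ExpStable.of_norm_exp_pow_le {a : R} {N : ℕ} (hN : 0 < N)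
    (ha : ‖NormedSpace.exp a ^ N‖ ≤ Real.exp (-1)) : ExpStable a := by
  have hN_pos : (0 : ℝ) < N := Nat.cast_pos.2 hN
  obtain ⟨C, hC⟩ := (isCompact_Icc (a := (0 : ℝ)) (b := N)).exists_bound_of_continuousOn
    (continuous_exp_smul a).continuousOn
  have hC_nonneg : 0 ≤ C := (norm_nonneg _).trans (hC 0 ⟨le_rfl, hN_pos.le⟩)
  refine ⟨max 1 ‖(1 : R)‖ * C * Real.exp 1, 1 / N, by positivity, fun t ht => ?_⟩
  set k := ⌊t / N⌋₊
  have hk_le : k * (N : ℝ) ≤ t := (le_div_iff₀ hN_pos).1 (Nat.floor_le (by positivity))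
  have hk_lt : t / N < k + 1 := Nat.lt_floor_add_one _
  have hrem : ‖NormedSpace.exp ((t - k * N) • a)‖ ≤ C :=
    hC _ ⟨sub_nonneg.2 hk_le, by linarith [(div_lt_iff₀ hN_pos).1 hk_lt]⟩
  have hpow : ‖(NormedSpace.exp a ^ N) ^ k‖ ≤ max 1 ‖(1 : R)‖ * Real.exp (-k) := by
    rcases k.eq_zero_or_pos with hk | hk
    · simp [hk]
    · calc ‖(NormedSpace.exp a ^ N) ^ k‖ ≤ Real.exp (-1) ^ k :=
            (norm_pow_le' _ hk).trans (pow_le_pow_left₀ (norm_nonneg _) ha k)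
        _ = Real.exp (-k) := by rw [← Real.exp_nat_mul, mul_neg_one]
        _ ≤ _ := le_mul_of_one_le_left (Real.exp_nonneg _) (le_max_left _ _)
  calc ‖NormedSpace.exp (t • a)‖
      = ‖NormedSpace.exp ((t - k * N) • a) * (NormedSpace.exp a ^ N) ^ k‖ := by
        rw [← exp_add_nat_mul_smul, sub_add_cancel]
    _ ≤ C * (max 1 ‖(1 : R)‖ * Real.exp (-k)) := norm_mul_le_of_le hrem hpow
    _ ≤ C * (max 1 ‖(1 : R)‖ * Real.exp (1 + -(1 / N * t))) := by
        gcongr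
        linarith [one_div_mul_eq_div (N : ℝ) t]
    _ = max 1 ‖(1 : R)‖ * C * Real.exp 1 * Real.exp (-(1 / N * t)) := by
        rw [Real.exp_add]
        ring

theorem ExpStable.of_tendsto_exp_pow {a : R}
    (ha : Tendsto (fun k : ℕ => NormedSpace.exp a ^ k) atTop (𝓝 0)) : ExpStable a := by
  have hsmall : ∀ᶠ k : ℕ in atTop, ‖NormedSpace.exp a ^ k‖ < Real.exp (-1) :=
    ha.norm.eventually_lt_const (by simpa using Real.exp_pos (-1))
  obtain ⟨N, hN, hN_pos⟩ := (hsmall.and (eventually_gt_atTop 0)).exists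
  exact .of_norm_exp_pow_le hN_pos hN.le

theorem tendsto_pow_zero_of_spectralRadius_lt_one {S : Type*} [NormedRing S] [NormedAlgebra ℂ S]
    [CompleteSpace S] {a : S} (ha : spectralRadius ℂ a < 1) :
    Tendsto (fun k : ℕ => a ^ k) atTop (𝓝 0) := by
  obtain ⟨r, har, hr⟩ := ENNReal.lt_iff_exists_nnreal_btwn.1 ha
  have hbound : ∀ᶠ k : ℕ in atTop, ‖a ^ k‖ ≤ (r : ℝ) ^ k := by
    filter_upwards [(spectrum.pow_nnnorm_pow_one_div_tendsto_nhds_spectralRadius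
      a).eventually_lt_const har, eventually_gt_atTop 0] with k hk hk_pos
    have hpow := ENNReal.rpow_le_rpow hk.le (Nat.cast_nonneg (α := ℝ) k)
    rw [← ENNReal.rpow_mul, one_div_mul_cancel (Nat.cast_ne_zero.2 hk_pos.ne'), ENNReal.rpow_one,
      ENNReal.rpow_natCast] at hpow
    exact_mod_cast hpow
  exact squeeze_zero_norm' hbound
    (tendsto_pow_atTop_nhds_zero_of_lt_one r.2 (by exact_mod_cast hr))

end ExpStable

section Spectrum

variable {E : Type*} [NormedAddCommGroup E] [NormedSpace ℂ E]

theorem exists_common_eigenvector_of_commute [FiniteDimensional ℂ E] {f g : Module.End ℂ E}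
    (hfg : Commute f g) {z : ℂ} (hz : g.HasEigenvalue z) :
    ∃ (μ : ℂ) (v : E), f.HasEigenvector μ v ∧ g.HasEigenvector z v := by
  have hmaps : ∀ v ∈ g.eigenspace z, f v ∈ g.eigenspace z :=
    Module.End.mapsTo_genEigenspace_of_comm hfg.symm z 1
  have : Nontrivial (g.eigenspace z) := Submodule.nontrivial_iff_ne_bot.2 hz
  obtain ⟨μ, hμ⟩ := Module.End.exists_eigenvalue (f.restrict hmaps)
  obtain ⟨v, hv⟩ := hμ.exists_hasEigenvector
  have hv_ne : (v : E) ≠ 0 := fun h => hv.2 (Subtype.ext h)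
  exact ⟨μ, v, ⟨Module.End.mem_eigenspace_iff.2 (congrArg Subtype.val hv.apply_eq_smul), hv_ne⟩,
    v.2, hv_ne⟩

theorem exp_apply_of_apply_eq_smul [CompleteSpace E] {a : E →L[ℂ] E} {μ : ℂ} {v : E}
    (hv : a v = μ • v) : NormedSpace.exp a v = Complex.exp μ • v := by
  have hpow (k : ℕ) : (a ^ k) v = μ ^ k • v := by
    induction k with
    | zero => simp
    | succ k ih => rw [pow_succ', mul_apply_eq_comp, ih, map_smul, hv,
        smul_smul, pow_succ]
  have hleft : HasSum (fun k : ℕ => ((k.factorial : ℂ)⁻¹ • a ^ k) v) (NormedSpace.exp a v) :=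
    (NormedSpace.exp_series_hasSum_exp' (𝕂 := ℂ) a).mapL (ContinuousLinearMap.apply ℂ E v)
  have hright : HasSum (fun k : ℕ => ((k.factorial : ℂ)⁻¹ • μ ^ k) • v) (Complex.exp μ • v) := by
    rw [Complex.exp_eq_exp_ℂ]
    exact (NormedSpace.exp_series_hasSum_exp' (𝕂 := ℂ) μ).smul_const v
  exact hleft.unique (hright.congr_fun fun k => by simp [hpow, smul_smul])

variable [FiniteDimensional ℂ E]

theorem exists_hasEigenvalue_of_mem_spectrum_exp {a : E →L[ℂ] E} {z : ℂ}
    (hz : z ∈ spectrum ℂ (NormedSpace.exp a)) :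
    ∃ μ : ℂ, Module.End.HasEigenvalue (a : E →ₗ[ℂ] E) μ ∧ z = Complex.exp μ := by
  have : CompleteSpace E := FiniteDimensional.complete ℂ E
  rw [← AlgEquiv.spectrum_eq (Module.End.toContinuousLinearMap (𝕜 := ℂ) E).symm,
    ← Module.End.hasEigenvalue_iff_mem_spectrum] at hz
  have hcomm : Commute (a : Module.End ℂ E)
      ((Module.End.toContinuousLinearMap (𝕜 := ℂ) E).symm (NormedSpace.exp a)) :=
    (Commute.refl a).exp_right.map (Module.End.toContinuousLinearMap (𝕜 := ℂ) E).symm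
  obtain ⟨μ, v, hva, hv⟩ := exists_common_eigenvector_of_commute hcomm hz
  exact ⟨μ, Module.End.hasEigenvalue_of_hasEigenvector hva, smul_left_injective ℂ hv.2
    (hv.apply_eq_smul.symm.trans (exp_apply_of_apply_eq_smul hva.apply_eq_smul))⟩

theorem tendsto_exp_pow_of_re_eigenvalue_neg {a : E →L[ℂ] E}
    (ha : ∀ z : ℂ, Module.End.HasEigenvalue (a : E →ₗ[ℂ] E) z → z.re < 0) :
    Tendsto (fun k : ℕ => NormedSpace.exp a ^ k) atTop (𝓝 0) := by
  have : CompleteSpace E := FiniteDimensional.complete ℂ E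
  rcases subsingleton_or_nontrivial E with hE | hE
  · simpa only [Subsingleton.elim _ (0 : E →L[ℂ] E)] using tendsto_const_nhds
  refine tendsto_pow_zero_of_spectralRadius_lt_one
    (spectrum.spectralRadius_lt_of_forall_lt _ (r := 1) fun z hz => ?_)
  obtain ⟨μ, hμ, rfl⟩ := exists_hasEigenvalue_of_mem_spectrum_exp hz
  rw [← NNReal.coe_lt_coe, coe_nnnorm, Complex.norm_exp]
  simpa using ha μ hμ

end Spectrum

section Complexify

variable {d : ℕ}

/-- The complexification of operators on `ℝ^d`, through their matrices in the standard basis. It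
replaces the base change in `Dissipative`, which does not come with a norm. -/
noncomputable def complexify (d : ℕ) :
    (EuclideanSpace ℝ (Fin d) →L[ℝ] EuclideanSpace ℝ (Fin d)) →ₐ[ℝ]
      (EuclideanSpace ℂ (Fin d) →L[ℂ] EuclideanSpace ℂ (Fin d)) :=
  (((Matrix.toEuclideanCLM (n := Fin d) (𝕜 := ℂ)).toAlgEquiv.toAlgHom.restrictScalars ℝ).comp
    Complex.ofRealAm.mapMatrix).comp
      (Matrix.toEuclideanCLM (n := Fin d) (𝕜 := ℝ)).symm.toAlgEquiv.toAlgHom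

theorem complexify_injective : Function.Injective (complexify d) :=
  (Matrix.toEuclideanCLM (n := Fin d) (𝕜 := ℂ)).injective.comp <|
    (Matrix.map_injective Complex.ofReal_injective).comp
      (Matrix.toEuclideanCLM (n := Fin d) (𝕜 := ℝ)).symm.injective

theorem charpoly_toEuclideanCLM {𝕜 : Type*} [RCLike 𝕜] (M : Matrix (Fin d) (Fin d) 𝕜) :
    LinearMap.charpoly (Matrix.toEuclideanCLM (n := Fin d) (𝕜 := 𝕜) M :
      EuclideanSpace 𝕜 (Fin d) →ₗ[𝕜] EuclideanSpace 𝕜 (Fin d)) = M.charpoly := by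
  rw [Matrix.coe_toEuclideanCLM_eq_toEuclideanLin, Matrix.toEuclideanLin_eq_toLin_orthonormal,
    Matrix.charpoly_toLin]

theorem charpoly_complexify (A : EuclideanSpace ℝ (Fin d) →L[ℝ] EuclideanSpace ℝ (Fin d)) :
    LinearMap.charpoly (complexify d A : EuclideanSpace ℂ (Fin d) →ₗ[ℂ] EuclideanSpace ℂ (Fin d)) =
      (LinearMap.charpoly (A : EuclideanSpace ℝ (Fin d) →ₗ[ℝ] EuclideanSpace ℝ (Fin d))).map
        (algebraMap ℝ ℂ) := by
  obtain ⟨M, rfl⟩ : ∃ M, A = Matrix.toEuclideanCLM (n := Fin d) (𝕜 := ℝ) M :=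
    ⟨_, ((Matrix.toEuclideanCLM (n := Fin d) (𝕜 := ℝ)).apply_symm_apply A).symm⟩
  have hM : complexify d (Matrix.toEuclideanCLM (𝕜 := ℝ) M) =
      Matrix.toEuclideanCLM (𝕜 := ℂ) (M.map (algebraMap ℝ ℂ)) := by
    refine congrArg (Matrix.toEuclideanCLM (n := Fin d) (𝕜 := ℂ)) ?_
    exact congrArg (fun N : Matrix (Fin d) (Fin d) ℝ => N.map (algebraMap ℝ ℂ))
      ((Matrix.toEuclideanCLM (n := Fin d) (𝕜 := ℝ)).symm_apply_apply M)
  rw [hM, charpoly_toEuclideanCLM, charpoly_toEuclideanCLM, Matrix.charpoly_map]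

theorem exp_complexify (A : EuclideanSpace ℝ (Fin d) →L[ℝ] EuclideanSpace ℝ (Fin d)) :
    NormedSpace.exp (complexify d A) = complexify d (NormedSpace.exp A) := by
  let := NormedAlgebra.restrictScalars ℚ ℝ
    (EuclideanSpace ℝ (Fin d) →L[ℝ] EuclideanSpace ℝ (Fin d))
  let := NormedAlgebra.restrictScalars ℚ ℂ
    (EuclideanSpace ℂ (Fin d) →L[ℂ] EuclideanSpace ℂ (Fin d))
  exact (NormedSpace.map_exp (complexify d)
    (LinearMap.continuous_of_finiteDimensional (complexify d).toLinearMap) A).symm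

theorem Dissipative.re_neg_of_hasEigenvalue_complexify
    {A : EuclideanSpace ℝ (Fin d) →L[ℝ] EuclideanSpace ℝ (Fin d)} (hD : Dissipative A) (z : ℂ)
    (hz : Module.End.HasEigenvalue
      (complexify d A : EuclideanSpace ℂ (Fin d) →ₗ[ℂ] EuclideanSpace ℂ (Fin d)) z) :
    z.re < 0 := by
  refine hD z ?_
  rw [Module.End.hasEigenvalue_iff_isRoot_charpoly] at hz ⊢
  rwa [LinearMap.charpoly_baseChange, ← charpoly_complexify]

theorem Dissipative.expStable {A : EuclideanSpace ℝ (Fin d) →L[ℝ] EuclideanSpace ℝ (Fin d)}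
    (hD : Dissipative A) : ExpStable A := by
  have hembed : IsClosedEmbedding (complexify d) :=
    LinearMap.isClosedEmbedding_of_injective (f := (complexify d).toLinearMap)
      (LinearMap.ker_eq_bot.2 complexify_injective)
  have hpow := tendsto_exp_pow_of_re_eigenvalue_neg hD.re_neg_of_hasEigenvalue_complexify
  refine .of_tendsto_exp_pow (hembed.tendsto_nhds_iff.2 ?_)
  simpa only [Function.comp_def, map_pow, map_zero, ← exp_complexify] using hpow

end Complexify

section Semigroup

variable {E : Type*} [NormedAddCommGroup E] [NormedSpace ℝ E]

theorem ExpStable.tendsto_exp_smul_apply {A : E →L[ℝ] E} (hA : ExpStable A) (x : E) :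
    Tendsto (fun t : ℝ => NormedSpace.exp (t • A) x) atTop (𝓝 0) := by
  obtain ⟨C, c, hc, hdecay⟩ := hA
  have hbound : ∀ᶠ t : ℝ in atTop,
      ‖NormedSpace.exp (t • A) x‖ ≤ C * Real.exp (-(c * t)) * ‖x‖ := by
    filter_upwards [eventually_ge_atTop 0] with t ht
    exact (NormedSpace.exp (t • A)).le_of_opNorm_le (hdecay t ht) x
  refine squeeze_zero_norm' hbound ?_
  have hexp : Tendsto (fun t : ℝ => Real.exp (-(c * t))) atTop (𝓝 0) :=
    Real.tendsto_exp_neg_atTop_nhds_zero.comp (tendsto_id.const_mul_atTop hc)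
  simpa using (hexp.const_mul C).mul_const ‖x‖

variable [CompleteSpace E]

theorem hasDerivAt_exp_smul_apply (A : E →L[ℝ] E) (x : E) (t : ℝ) :
    HasDerivAt (fun t : ℝ => NormedSpace.exp (t • A) x) (A (NormedSpace.exp (t • A) x)) t := by
  simpa using (hasDerivAt_exp_smul_const' (𝕂 := ℝ) A t).clm_apply (hasDerivAt_const t x)

end Semigroup

section Gramian

variable {E : Type*} [NormedAddCommGroup E] [InnerProductSpace ℝ E] [CompleteSpace E]

/-- The observability Gramian `∫_0^∞ (e^{sA})^* e^{sA} ds` of `A`. -/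
noncomputable def gramian (A : E →L[ℝ] E) : E →L[ℝ] E :=
  ∫ s in Ioi (0 : ℝ), (NormedSpace.exp (s • A)).adjoint ∘L NormedSpace.exp (s • A)

/-- The quadratic form of the Gramian, which is a Lyapunov function for `x' = A x`. -/
noncomputable def gramianForm (A : E →L[ℝ] E) (x : E) : ℝ := inner ℝ x (gramian A x)

/-- A rate at which `gramianForm A` decays along `x' = A x` even under small perturbations; the
summand `1` only serves to make it positive. -/
noncomputable def decayRate (A : E →L[ℝ] E) : ℝ := (4 * (‖gramian A‖ + 1))⁻¹

/-- A constant `κ` with `‖x‖ ^ 2 ≤ κ * gramianForm A x`. -/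
noncomputable def coercivityConst (A : E →L[ℝ] E) : ℝ := (‖gramian A‖ * ‖A‖ ^ 2 + 1) ^ 2

variable {A : E →L[ℝ] E}

theorem decayRate_pos : 0 < decayRate A := by unfold decayRate; positivity

theorem decayRate_le_one_fourth : decayRate A ≤ 1 / 4 := by
  rw [decayRate, ← one_div]
  exact one_div_le_one_div_of_le (by norm_num) (by linarith [norm_nonneg (gramian A)])

theorem decayRate_mul_norm_gramian_le : decayRate A * ‖gramian A‖ ≤ 1 / 4 := by
  rw [decayRate, inv_mul_le_iff₀ (by positivity)]
  linarith

theorem one_le_coercivityConst : 1 ≤ coercivityConst A :=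
  one_le_pow₀ (le_add_of_nonneg_left (by positivity))

theorem coercivityConst_nonneg : 0 ≤ coercivityConst A :=
  zero_le_one.trans one_le_coercivityConst

theorem eight_mul_sq_norm_gramian_mul_le_one_fourth {ε : ℝ} (hε : 0 ≤ ε)
    (hε_small : 16 * ‖gramian A‖ ^ 2 * coercivityConst A * ε ≤ decayRate A) :
    8 * ‖gramian A‖ ^ 2 * ε ≤ 1 / 4 := by
  have hε_le : ε ≤ coercivityConst A * ε := le_mul_of_one_le_left hε one_le_coercivityConst
  linarith [decayRate_le_one_fourth (A := A), mul_le_mul_of_nonneg_left hε_le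
    (sq_nonneg ‖gramian A‖)]

@[fun_prop]
theorem continuous_gramianForm : Continuous (gramianForm A) := by
  unfold gramianForm
  fun_prop

@[simp]
theorem gramianForm_zero : gramianForm A 0 = 0 := by simp [gramianForm]

theorem gramianForm_neg (x : E) : gramianForm A (-x) = gramianForm A x := by simp [gramianForm]

theorem gramianForm_le (x : E) : gramianForm A x ≤ ‖gramian A‖ * ‖x‖ ^ 2 :=
  calc gramianForm A x ≤ ‖x‖ * ‖gramian A x‖ := real_inner_le_norm _ _
    _ ≤ ‖x‖ * (‖gramian A‖ * ‖x‖) := by gcongr; exact (gramian A).le_opNorm x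
    _ = ‖gramian A‖ * ‖x‖ ^ 2 := by ring

theorem decayRate_mul_gramianForm_le (x : E) : decayRate A * gramianForm A x ≤ 1 / 4 * ‖x‖ ^ 2 :=
  calc decayRate A * gramianForm A x ≤ decayRate A * (‖gramian A‖ * ‖x‖ ^ 2) :=
        mul_le_mul_of_nonneg_left (gramianForm_le x) decayRate_pos.le
    _ = decayRate A * ‖gramian A‖ * ‖x‖ ^ 2 := (mul_assoc _ _ _).symm
    _ ≤ 1 / 4 * ‖x‖ ^ 2 := by gcongr; exact decayRate_mul_norm_gramian_le

namespace ExpStable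

theorem integrableOn_adjoint_comp_exp (hA : ExpStable A) :
    IntegrableOn (fun s : ℝ => (NormedSpace.exp (s • A)).adjoint ∘L NormedSpace.exp (s • A))
      (Ioi 0) := by
  obtain ⟨C, c, hc, hdecay⟩ := hA
  have hcont : Continuous fun s : ℝ =>
      (NormedSpace.exp (s • A)).adjoint ∘L NormedSpace.exp (s • A) :=
    (ContinuousLinearMap.adjoint.continuous.comp (continuous_exp_smul A)).clm_comp
      (continuous_exp_smul A)
  have hdom : IntegrableOn (fun s : ℝ => C ^ 2 * Real.exp (-(2 * c) * s)) (Ioi 0) :=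
    (exp_neg_integrableOn_Ioi 0 (by positivity)).const_mul _
  refine hdom.mono' hcont.aestronglyMeasurable ?_
  filter_upwards [ae_restrict_mem measurableSet_Ioi] with s hs
  calc ‖(NormedSpace.exp (s • A)).adjoint ∘L NormedSpace.exp (s • A)‖
      = ‖NormedSpace.exp (s • A)‖ ^ 2 := by
        rw [ContinuousLinearMap.norm_adjoint_comp_self, sq]
    _ ≤ (C * Real.exp (-(c * s))) ^ 2 := by gcongr; exact hdecay s (le_of_lt hs)
    _ = C ^ 2 * Real.exp (-(2 * c) * s) := by
        rw [mul_pow, ← Real.exp_nat_mul]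
        ring_nf

theorem integrableOn_inner_exp_apply (hA : ExpStable A) (x y : E) :
    IntegrableOn (fun s : ℝ => inner ℝ (NormedSpace.exp (s • A) x) (NormedSpace.exp (s • A) y))
      (Ioi 0) := by
  simpa [IntegrableOn, ContinuousLinearMap.adjoint_inner_right] using
    ((innerSL ℝ x).comp (ContinuousLinearMap.apply ℝ E y)).integrable_comp
      hA.integrableOn_adjoint_comp_exp

theorem inner_gramian (hA : ExpStable A) (x y : E) :
    inner ℝ x (gramian A y) =
      ∫ s in Ioi (0 : ℝ), inner ℝ (NormedSpace.exp (s • A) x) (NormedSpace.exp (s • A) y) := by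
  simpa [gramian, ContinuousLinearMap.adjoint_inner_right] using
    (((innerSL ℝ x).comp (ContinuousLinearMap.apply ℝ E y)).integral_comp_comm
      hA.integrableOn_adjoint_comp_exp).symm

theorem gramianForm_eq_integral (hA : ExpStable A) (x : E) :
    gramianForm A x = ∫ s in Ioi (0 : ℝ), ‖NormedSpace.exp (s • A) x‖ ^ 2 := by
  simp only [gramianForm, hA.inner_gramian, real_inner_self_eq_norm_sq]

theorem gramianForm_nonneg (hA : ExpStable A) (x : E) : 0 ≤ gramianForm A x := by
  rw [hA.gramianForm_eq_integral]
  exact integral_nonneg fun s => sq_nonneg _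

theorem inner_gramian_comm (hA : ExpStable A) (x y : E) :
    inner ℝ x (gramian A y) = inner ℝ y (gramian A x) := by
  simp only [hA.inner_gramian, real_inner_comm]

theorem gramianForm_add (hA : ExpStable A) (x y : E) :
    gramianForm A (x + y) = gramianForm A x + 2 * inner ℝ x (gramian A y) + gramianForm A y := by
  simp only [gramianForm, map_add, inner_add_left, inner_add_right, hA.inner_gramian_comm y x]
  ring

theorem two_mul_inner_gramian_le (hA : ExpStable A) (x y : E) :
    2 * inner ℝ x (gramian A y) ≤ gramianForm A x + gramianForm A y := by
  have hexpand := hA.gramianForm_add x (-y)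
  rw [gramianForm_neg, map_neg, inner_neg_right] at hexpand
  linarith [hA.gramianForm_nonneg (x + -y)]

theorem two_mul_inner_apply_gramian (hA : ExpStable A) (x : E) :
    2 * inner ℝ (A x) (gramian A x) = -‖x‖ ^ 2 := by
  have hderiv (s : ℝ) : HasDerivAt (fun s : ℝ => ‖NormedSpace.exp (s • A) x‖ ^ 2)
      (2 * inner ℝ (NormedSpace.exp (s • A) (A x)) (NormedSpace.exp (s • A) x)) s := by
    have hcomm : NormedSpace.exp (s • A) (A x) = A (NormedSpace.exp (s • A) x) :=
      DFunLike.congr_fun ((Commute.refl A).smul_left s).exp_left.eq x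
    simpa only [hcomm, real_inner_comm] using (hasDerivAt_exp_smul_apply A x s).norm_sq
  have hlim : Tendsto (fun s : ℝ => ‖NormedSpace.exp (s • A) x‖ ^ 2) atTop (𝓝 0) := by
    simpa using (hA.tendsto_exp_smul_apply x).norm.pow 2
  have hftc := integral_Ioi_of_hasDerivAt_of_tendsto' (fun s _ => hderiv s)
    ((hA.integrableOn_inner_exp_apply (A x) x).const_mul 2) hlim
  simpa [integral_const_mul, ← hA.inner_gramian] using hftc

theorem norm_sq_le_gramianForm (hA : ExpStable A) (x : E) :
    ‖x‖ ^ 2 ≤ coercivityConst A * gramianForm A x := by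
  set l : ℝ := ‖gramian A‖ * ‖A‖ ^ 2 + 1 with hl
  -- The Lyapunov equation turns `0 ≤ V (l x + A x)` into `l ‖x‖² ≤ l² V x + V (A x)`.
  have hexpand : gramianForm A (l • x + A x) =
      l ^ 2 * gramianForm A x - l * ‖x‖ ^ 2 + gramianForm A (A x) := by
    have hlyap := hA.two_mul_inner_apply_gramian x
    rw [hA.inner_gramian_comm] at hlyap
    rw [hA.gramianForm_add]
    simp only [gramianForm, map_smul, real_inner_smul_left, real_inner_smul_right]
    linear_combination l * hlyap
  have himage : gramianForm A (A x) ≤ (l - 1) * ‖x‖ ^ 2 :=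
    calc gramianForm A (A x) ≤ ‖gramian A‖ * ‖A x‖ ^ 2 := gramianForm_le _
      _ ≤ ‖gramian A‖ * (‖A‖ * ‖x‖) ^ 2 := by gcongr; exact A.le_opNorm x
      _ = (l - 1) * ‖x‖ ^ 2 := by rw [hl]; ring
  have hpos := hA.gramianForm_nonneg (l • x + A x)
  rw [coercivityConst, ← hl]
  linarith

end ExpStable

end Gramian

section ExpConv

/-- The convolution `∫_0^t e^{-c(t-s)} g(s) ds` with an exponential kernel. -/
noncomputable def expConv (c : ℝ) (g : ℝ → ℝ) (t : ℝ) : ℝ :=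
  ∫ s in (0 : ℝ)..t, Real.exp (-(c * (t - s))) * g s

variable {c t : ℝ} {g h : ℝ → ℝ}

theorem expConv_eq_mul (c : ℝ) (g : ℝ → ℝ) (t : ℝ) :
    expConv c g t = Real.exp (-(c * t)) * ∫ s in (0 : ℝ)..t, Real.exp (c * s) * g s := by
  rw [expConv, ← intervalIntegral.integral_const_mul]
  congr with s
  rw [← mul_assoc, ← Real.exp_add]
  ring_nf

theorem expConv_const_mul (c k : ℝ) (g : ℝ → ℝ) (t : ℝ) :
    expConv c (fun s => k * g s) t = k * expConv c g t := by
  simp only [expConv, mul_left_comm _ k, intervalIntegral.integral_const_mul]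

theorem expConv_add (hg : Continuous g) (hh : Continuous h) :
    expConv c (fun s => g s + h s) t = expConv c g t + expConv c h t := by
  simp only [expConv, mul_add]
  exact intervalIntegral.integral_add (Continuous.intervalIntegrable (by fun_prop) _ _)
    (Continuous.intervalIntegrable (by fun_prop) _ _)

theorem expConv_mono (ht : 0 ≤ t) (hg : Continuous g) (hh : Continuous h)
    (hgh : ∀ s ∈ Icc 0 t, g s ≤ h s) : expConv c g t ≤ expConv c h t :=
  intervalIntegral.integral_mono_on ht (Continuous.intervalIntegrable (by fun_prop) _ _)
    (Continuous.intervalIntegrable (by fun_prop) _ _)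
    fun s hs => mul_le_mul_of_nonneg_left (hgh s hs) (Real.exp_nonneg _)

theorem expConv_exp (c t : ℝ) :
    expConv c (fun s => Real.exp (-(c * s))) t = t * Real.exp (-(c * t)) := by
  simp [expConv_eq_mul, ← Real.exp_add, mul_comm]

theorem expConv_one_le (hc : 0 < c) (t : ℝ) : expConv c (fun _ => 1) t ≤ 1 / c := by
  have hderiv (s : ℝ) : HasDerivAt (fun s => Real.exp (-(c * (t - s))) / c)
      (Real.exp (-(c * (t - s))) * 1) s := by
    convert! ((((hasDerivAt_id s).const_sub t).const_mul c).neg.exp.div_const c) using 1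
    simp [hc.ne']
  rw [expConv, intervalIntegral.integral_eq_sub_of_hasDerivAt (fun s _ => hderiv s)
    (Continuous.intervalIntegrable (by fun_prop) _ _)]
  simp only [sub_self, mul_zero, neg_zero, Real.exp_zero, sub_le_self_iff]
  positivity

theorem expConv_sub_le (hc : 0 < c) (ht : 0 ≤ t) :
    expConv c (fun s => t - s) t ≤ 1 / c ^ 2 := by
  have hderiv (s : ℝ) : HasDerivAt
      (fun s => Real.exp (-(c * (t - s))) * ((t - s) / c + 1 / c ^ 2))
      (Real.exp (-(c * (t - s))) * (t - s)) s := by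
    have hsub := (hasDerivAt_id s).const_sub t
    convert! (hsub.const_mul c).neg.exp.mul ((hsub.div_const c).add_const (1 / c ^ 2)) using 1
    simp only [id_eq, Pi.neg_apply]
    field_simp
    ring
  rw [expConv, intervalIntegral.integral_eq_sub_of_hasDerivAt (fun s _ => hderiv s)
    (Continuous.intervalIntegrable (by fun_prop) _ _)]
  simp only [sub_self, mul_zero, neg_zero, Real.exp_zero, zero_div, zero_add, one_mul, sub_zero,
    sub_le_self_iff]
  positivity

theorem mul_exp_neg_mul_le (hc : 0 < c) (t : ℝ) : t * Real.exp (-(c * t)) ≤ 1 / c := by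
  rw [le_div_iff₀ hc, Real.exp_neg, mul_right_comm, ← div_eq_mul_inv, div_le_one (Real.exp_pos _)]
  linarith [Real.add_one_le_exp (c * t)]

theorem le_exp_mul_add_expConv_of_deriv_le {q q' : ℝ → ℝ}
    (hq : ∀ s ∈ Ici 0, HasDerivWithinAt q (q' s) (Ici 0) s) (hg : Continuous g)
    (hle : ∀ s ∈ Ici 0, q' s ≤ -c * q s + g s) (ht : 0 ≤ t) :
    q t ≤ Real.exp (-(c * t)) * q 0 + expConv c g t := by
  have hcont : Continuous fun s => Real.exp (c * s) * g s := by fun_prop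
  set G := fun t => ∫ s in (0 : ℝ)..t, Real.exp (c * s) * g s with hG
  have hderiv : ∀ s ∈ Ici 0, HasDerivWithinAt (fun s => Real.exp (c * s) * q s - G s)
      (Real.exp (c * s) * (c * q s + q' s - g s)) (Ici 0) s := by
    intro s hs
    have hexp := ((hasDerivAt_id s).const_mul c).exp.hasDerivWithinAt (s := Ici 0)
    have hint := (hcont.integral_hasStrictDerivAt 0 s).hasDerivAt.hasDerivWithinAt (s := Ici 0)
    refine ((hexp.mul (hq s hs)).sub hint).congr_deriv ?_
    simp only [id_eq]
    ring
  have hanti : AntitoneOn (fun s => Real.exp (c * s) * q s - G s) (Ici 0) := by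
    refine antitoneOn_of_hasDerivWithinAt_nonpos (convex_Ici 0)
      (fun s hs => (hderiv s hs).continuousWithinAt)
      (fun s hs => (hderiv s (interior_subset hs)).mono interior_subset) fun s hs => ?_
    have := hle s (interior_subset hs)
    exact mul_nonpos_of_nonneg_of_nonpos (Real.exp_nonneg _) (by linarith)
  have hcompare := hanti self_mem_Ici ht ht
  simp only [hG, mul_zero, Real.exp_zero, one_mul, intervalIntegral.integral_same,
    sub_zero] at hcompare
  calc q t = Real.exp (-(c * t)) * (Real.exp (c * t) * q t) := by
        rw [← mul_assoc, ← Real.exp_add, neg_add_cancel, Real.exp_zero, one_mul]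
    _ ≤ Real.exp (-(c * t)) * (q 0 + G t) := by gcongr; linarith
    _ = _ := by rw [mul_add, expConv_eq_mul]

end ExpConv

section ForcedPath

theorem norm_add_sq_le_two_mul {E : Type*} [SeminormedAddCommGroup E] (x y : E) :
    ‖x + y‖ ^ 2 ≤ 2 * ‖x‖ ^ 2 + 2 * ‖y‖ ^ 2 := by
  have := pow_le_pow_left₀ (norm_nonneg _) (norm_add_le x y) 2
  linarith [two_mul_le_add_sq ‖x‖ ‖y‖]

theorem norm_add_add_sq_le {E : Type*} [SeminormedAddCommGroup E] (x y z : E) :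
    ‖x + y + z‖ ^ 2 ≤ 4 * ‖x‖ ^ 2 + 4 * ‖y‖ ^ 2 + 2 * ‖z‖ ^ 2 := by
  linarith [norm_add_sq_le_two_mul (x + y) z, norm_add_sq_le_two_mul x y]

section NormedSpace

variable {E : Type*} [NormedAddCommGroup E] [NormedSpace ℝ E]

/-- The solution `∫_0^t e^{(t-s)A} f(s) ds` of `y' = A y + f` with `y 0 = 0`, with `e^{tA}` taken
out of the integral. -/
noncomputable def duhamel (A : E →L[ℝ] E) (f : ℝ → E) (t : ℝ) : E :=
  NormedSpace.exp (t • A) (∫ s in (0 : ℝ)..t, NormedSpace.exp ((-s) • A) (f s))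

/-- The solution `z_t = b_t + ∫_0^t A e^{(t-s)A} b_s ds` of `z_t = ∫_0^t A z_s ds + b_t`. For a
Brownian path `b` it is a path of the Ornstein-Uhlenbeck process. -/
noncomputable def ouPath (A : E →L[ℝ] E) (b : ℝ → E) (t : ℝ) : E := b t + A (duhamel A b t)

/-- The path `u` solves `u_t = x + ∫_0^t (A u_s + F(u_s)) ds + b_t` on `[0, ∞)`. -/
structure IsForcedPath (A : E →L[ℝ] E) (F : E → E) (x : E) (b u : ℝ → E) : Prop where
  continuous_force : Continuous b
  continuous : Continuous u
  eqn : ∀ t, 0 ≤ t → u t = x + (∫ s in (0 : ℝ)..t, (A (u s) + F (u s))) + b t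

@[simp]
theorem duhamel_zero (A : E →L[ℝ] E) (f : ℝ → E) : duhamel A f 0 = 0 := by simp [duhamel]

variable [CompleteSpace E] {A : E →L[ℝ] E} {b f : ℝ → E}

theorem exp_smul_exp_neg_smul_apply (A : E →L[ℝ] E) (t : ℝ) (x : E) :
    NormedSpace.exp (t • A) (NormedSpace.exp ((-t) • A) x) = x := by
  have hinv := exp_add_smul A t (-t)
  rw [add_neg_cancel, zero_smul, NormedSpace.exp_zero] at hinv
  exact (DFunLike.congr_fun hinv x).symm

theorem hasDerivAt_duhamel (A : E →L[ℝ] E) (hf : Continuous f) (t : ℝ) :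
    HasDerivAt (duhamel A f) (A (duhamel A f t) + f t) t := by
  have hcont : Continuous fun s : ℝ => NormedSpace.exp ((-s) • A) (f s) :=
    ((continuous_exp_smul A).comp continuous_neg).clm_apply hf
  refine ((hasDerivAt_exp_smul_const' (𝕂 := ℝ) A t).clm_apply
    (hcont.integral_hasStrictDerivAt 0 t).hasDerivAt).congr_deriv ?_
  rw [exp_smul_exp_neg_smul_apply]
  rfl

theorem continuous_duhamel (A : E →L[ℝ] E) (hf : Continuous f) : Continuous (duhamel A f) :=
  continuous_iff_continuousAt.2 fun t => (hasDerivAt_duhamel A hf t).continuousAt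

theorem continuous_ouPath (A : E →L[ℝ] E) (hb : Continuous b) : Continuous (ouPath A b) :=
  hb.add (A.continuous.comp (continuous_duhamel A hb))

theorem IsForcedPath.hasDerivWithinAt_sub_ouPath {F : E → E} (hF : Continuous F) {x : E}
    {u : ℝ → E} (hu : IsForcedPath A F x b u) {t : ℝ} (ht : t ∈ Ici 0) :
    HasDerivWithinAt (fun t => u t - ouPath A b t)
      (A (u t - ouPath A b t) + F (u t)) (Ici 0) t := by
  have hcont : Continuous fun s => A (u s) + F (u s) := by
    have := hu.continuous
    fun_prop
  have hsub : ∀ s ∈ Ici (0 : ℝ), u s - ouPath A b s =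
      x + (∫ r in (0 : ℝ)..s, (A (u r) + F (u r))) - A (duhamel A b s) := by
    intro s hs
    rw [hu.eqn s hs, ouPath, add_comm (b s), add_sub_add_right_eq_sub]
  have hderiv := ((hcont.integral_hasStrictDerivAt 0 t).hasDerivAt.const_add x).sub
    (A.hasFDerivAt.comp_hasDerivAt t (hasDerivAt_duhamel A hu.continuous_force t))
  refine (hderiv.hasDerivWithinAt.congr hsub (hsub t ht)).congr_deriv ?_
  simp only [ouPath, map_add, map_sub]
  abel

end NormedSpace

variable {E : Type*} [NormedAddCommGroup E] [InnerProductSpace ℝ E] [CompleteSpace E]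
  {A : E →L[ℝ] E}

namespace ExpStable

theorem gramianForm_le_of_hasDerivWithinAt (hA : ExpStable A) {ε : ℝ}
    (hε : 2 * ‖gramian A‖ ^ 2 * ε ≤ 1 / 4) {y f : ℝ → E} {g : ℝ → ℝ} (hg : Continuous g)
    (hy : ∀ s ∈ Ici 0, HasDerivWithinAt y (A (y s) + f s) (Ici 0) s)
    (hf : ∀ s ∈ Ici 0, ‖f s‖ ^ 2 ≤ ε * ‖y s‖ ^ 2 + g s) {t : ℝ} (ht : 0 ≤ t) :
    gramianForm A (y t) ≤ Real.exp (-(decayRate A * t)) * gramianForm A (y 0) +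
      2 * ‖gramian A‖ ^ 2 * expConv (decayRate A) g t := by
  rw [← expConv_const_mul]
  refine le_exp_mul_add_expConv_of_deriv_le (q := fun s => gramianForm A (y s))
    (q' := fun s => -‖y s‖ ^ 2 + 2 * inner ℝ (f s) (gramian A (y s))) ?_ (by fun_prop) ?_ ht
  · intro s hs
    refine ((hy s hs).inner ℝ ((gramian A).hasFDerivAt.comp_hasDerivWithinAt s
      (hy s hs))).congr_deriv ?_
    rw [← hA.two_mul_inner_apply_gramian, Function.comp_apply, hA.inner_gramian_comm (y s),
      inner_add_left]
    ring
  · intro s hs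
    have hcross : 2 * inner ℝ (f s) (gramian A (y s)) ≤
        2 * ‖gramian A‖ ^ 2 * ‖f s‖ ^ 2 + 1 / 2 * ‖y s‖ ^ 2 :=
      calc 2 * inner ℝ (f s) (gramian A (y s)) ≤ 2 * (‖f s‖ * (‖gramian A‖ * ‖y s‖)) := by
            gcongr
            exact (real_inner_le_norm _ _).trans (by gcongr; exact (gramian A).le_opNorm _)
        _ ≤ _ := by linarith [sq_nonneg (2 * (‖gramian A‖ * ‖f s‖) - ‖y s‖)]
    have hforce : 2 * ‖gramian A‖ ^ 2 * ‖f s‖ ^ 2 ≤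
        1 / 4 * ‖y s‖ ^ 2 + 2 * ‖gramian A‖ ^ 2 * g s :=
      calc 2 * ‖gramian A‖ ^ 2 * ‖f s‖ ^ 2 ≤ 2 * ‖gramian A‖ ^ 2 * (ε * ‖y s‖ ^ 2 + g s) := by
            gcongr
            exact hf s hs
        _ = 2 * ‖gramian A‖ ^ 2 * ε * ‖y s‖ ^ 2 + 2 * ‖gramian A‖ ^ 2 * g s := by ring
        _ ≤ _ := by gcongr
    linarith [decayRate_mul_gramianForm_le (A := A) (y s)]

theorem gramianForm_exp_smul_apply_le (hA : ExpStable A) (x : E) {t : ℝ} (ht : 0 ≤ t) :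
    gramianForm A (NormedSpace.exp (t • A) x) ≤
      Real.exp (-(decayRate A * t)) * gramianForm A x := by
  have hlyap := hA.gramianForm_le_of_hasDerivWithinAt (ε := 0) (f := 0) (g := 0)
    (by norm_num) continuous_const
    (fun s _ => by simpa using (hasDerivAt_exp_smul_apply A x s).hasDerivWithinAt) (by simp) ht
  rw [zero_smul, NormedSpace.exp_zero] at hlyap
  simpa [expConv] using hlyap

theorem norm_sq_exp_smul_apply_le (hA : ExpStable A) (x : E) {t : ℝ} (ht : 0 ≤ t) :
    ‖NormedSpace.exp (t • A) x‖ ^ 2 ≤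
      coercivityConst A * gramianForm A x * Real.exp (-(decayRate A * t)) :=
  calc ‖NormedSpace.exp (t • A) x‖ ^ 2
      ≤ coercivityConst A * gramianForm A (NormedSpace.exp (t • A) x) := hA.norm_sq_le_gramianForm _
    _ ≤ coercivityConst A * (Real.exp (-(decayRate A * t)) * gramianForm A x) :=
        mul_le_mul_of_nonneg_left (hA.gramianForm_exp_smul_apply_le x ht) coercivityConst_nonneg
    _ = _ := by ring

theorem expConv_norm_sq_exp_smul_apply_le (hA : ExpStable A) (x : E) {t : ℝ} (ht : 0 ≤ t) :
    expConv (decayRate A) (fun s => ‖NormedSpace.exp (s • A) x‖ ^ 2) t ≤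
      coercivityConst A * gramianForm A x * (t * Real.exp (-(decayRate A * t))) := by
  rw [← expConv_exp, ← expConv_const_mul]
  exact expConv_mono ht (by fun_prop) (by fun_prop)
    fun s hs => hA.norm_sq_exp_smul_apply_le x hs.1

theorem norm_sq_ouPath_le (hA : ExpStable A) {b : ℝ → E} (hb : Continuous b) {t : ℝ}
    (ht : 0 ≤ t) :
    ‖ouPath A b t‖ ^ 2 ≤ 2 * coercivityConst A *
      (2 * ‖gramian A‖ ^ 2 * ‖A‖ ^ 2 * expConv (decayRate A) (fun s => ‖b s - b t‖ ^ 2) t +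
        ‖gramian A‖ * (‖b t‖ ^ 2 * Real.exp (-(decayRate A * t)))) := by
  -- With `t` fixed, `y` solves `y' = A y + A (b - b t)` from `y 0 = 0`, so that only increments
  -- of `b` enter.
  set y : ℝ → E := fun s => A (duhamel A b s) + b t - NormedSpace.exp (s • A) (b t) with hy
  have hderiv (s : ℝ) : HasDerivAt y (A (y s) + A (b s - b t)) s := by
    refine (((A.hasFDerivAt.comp_hasDerivAt s (hasDerivAt_duhamel A hb s)).add_const (b t)).sub
      (hasDerivAt_exp_smul_apply A (b t) s)).congr_deriv ?_
    simp only [hy, map_add, map_sub]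
    abel
  have hforce (s : ℝ) : ‖A (b s - b t)‖ ^ 2 ≤ 0 * ‖y s‖ ^ 2 + ‖A‖ ^ 2 * ‖b s - b t‖ ^ 2 := by
    rw [zero_mul, zero_add, ← mul_pow]
    gcongr
    exact A.le_opNorm _
  have hform : gramianForm A (y t) ≤
      2 * ‖gramian A‖ ^ 2 * ‖A‖ ^ 2 * expConv (decayRate A) (fun s => ‖b s - b t‖ ^ 2) t := by
    simpa [hy, expConv_const_mul, mul_assoc] using hA.gramianForm_le_of_hasDerivWithinAt
      (by norm_num) (by fun_prop) (fun s _ => (hderiv s).hasDerivWithinAt) (fun s _ => hforce s) ht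
  have hsplit : ouPath A b t = y t + NormedSpace.exp (t • A) (b t) := by
    rw [hy, sub_add_cancel, ouPath, add_comm]
  have hfree : ‖NormedSpace.exp (t • A) (b t)‖ ^ 2 ≤
      coercivityConst A * (‖gramian A‖ * (‖b t‖ ^ 2 * Real.exp (-(decayRate A * t)))) := by
    refine (hA.norm_sq_exp_smul_apply_le (b t) ht).trans ?_
    rw [mul_assoc, ← mul_assoc ‖gramian A‖]
    gcongr
    · exact coercivityConst_nonneg
    · exact gramianForm_le _
  have hcoercive := (hA.norm_sq_le_gramianForm (y t)).trans
    (mul_le_mul_of_nonneg_left hform coercivityConst_nonneg)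
  rw [hsplit]
  linarith [norm_add_sq_le_two_mul (y t) (NormedSpace.exp (t • A) (b t))]

end ExpStable

namespace IsForcedPath

variable {F : E → E} {K ε : ℝ} {x : E} {b u : ℝ → E}

theorem gramianForm_sub_ouPath_le (hu : IsForcedPath A F x b u) (hA : ExpStable A)
    (hF : Continuous F) (hε : 0 ≤ ε) (hε_small : 4 * ‖gramian A‖ ^ 2 * ε ≤ 1 / 4)
    (hFK : ∀ v, ‖F v‖ ^ 2 ≤ K + ε * ‖v‖ ^ 2) {t : ℝ} (ht : 0 ≤ t) :
    gramianForm A (u t - ouPath A b t) ≤ Real.exp (-(decayRate A * t)) * gramianForm A x +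
      2 * ‖gramian A‖ ^ 2 * expConv (decayRate A) (fun s => K + 2 * ε * ‖ouPath A b s‖ ^ 2) t := by
  have hcont := continuous_ouPath A hu.continuous_force
  have hstart : u 0 - ouPath A b 0 = x := by simp [hu.eqn 0 le_rfl, ouPath]
  rw [← hstart]
  refine hA.gramianForm_le_of_hasDerivWithinAt (ε := 2 * ε) (by linarith) (by fun_prop)
    (fun s hs => hu.hasDerivWithinAt_sub_ouPath hF hs) (fun s _ => ?_) ht
  have hsq := norm_add_sq_le_two_mul (u s - ouPath A b s) (ouPath A b s)
  rw [sub_add_cancel] at hsq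
  linarith [hFK (u s), mul_le_mul_of_nonneg_left hsq hε]

theorem gramianForm_remainder_le (hu : IsForcedPath A F x b u) (hA : ExpStable A)
    (hF : Continuous F) (hε : 0 ≤ ε)
    (hε_small : 16 * ‖gramian A‖ ^ 2 * coercivityConst A * ε ≤ decayRate A)
    (hFK : ∀ v, ‖F v‖ ^ 2 ≤ K + ε * ‖v‖ ^ 2) {t : ℝ} (ht : 0 ≤ t) :
    gramianForm A (u t - ouPath A b t - NormedSpace.exp (t • A) x) ≤
      decayRate A / 2 * t * Real.exp (-(decayRate A * t)) * gramianForm A x +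
      2 * ‖gramian A‖ ^ 2 * expConv (decayRate A) (fun s => K + 2 * ε * ‖ouPath A b s‖ ^ 2) t := by
  set r : ℝ → E := fun s => u s - ouPath A b s - NormedSpace.exp (s • A) x with hr
  have hcont := continuous_ouPath A hu.continuous_force
  have hderiv : ∀ s ∈ Ici 0, HasDerivWithinAt r (A (r s) + F (u s)) (Ici 0) s := by
    intro s hs
    refine ((hu.hasDerivWithinAt_sub_ouPath hF hs).sub
      (hasDerivAt_exp_smul_apply A x s).hasDerivWithinAt).congr_deriv ?_
    rw [hr, map_sub A (u s - ouPath A b s)]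
    abel
  have hforce : ∀ s ∈ Ici 0, ‖F (u s)‖ ^ 2 ≤ 4 * ε * ‖r s‖ ^ 2 +
      ((K + 2 * ε * ‖ouPath A b s‖ ^ 2) + 4 * ε * ‖NormedSpace.exp (s • A) x‖ ^ 2) := by
    intro s _
    have hsq := norm_add_add_sq_le (r s) (NormedSpace.exp (s • A) x) (ouPath A b s)
    have hsum : r s + NormedSpace.exp (s • A) x + ouPath A b s = u s := by simp [hr]
    rw [hsum] at hsq
    linarith [hFK (u s), mul_le_mul_of_nonneg_left hsq hε]
  have hlyap := hA.gramianForm_le_of_hasDerivWithinAt (ε := 4 * ε)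
    (by linarith [eight_mul_sq_norm_gramian_mul_le_one_fourth hε hε_small]) (by fun_prop)
    hderiv hforce ht
  rw [expConv_add (by fun_prop) (by fun_prop), expConv_const_mul] at hlyap
  have hcost : 2 * ‖gramian A‖ ^ 2 * (4 * ε * (coercivityConst A * gramianForm A x *
      (t * Real.exp (-(decayRate A * t))))) ≤
      decayRate A / 2 * t * Real.exp (-(decayRate A * t)) * gramianForm A x := by
    have hnonneg : 0 ≤ t * Real.exp (-(decayRate A * t)) * gramianForm A x :=
      mul_nonneg (by positivity) (hA.gramianForm_nonneg x)
    linarith [mul_le_mul_of_nonneg_right hε_small hnonneg]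
  have hstart : r 0 = 0 := by simp [hr, hu.eqn 0 le_rfl, ouPath, NormedSpace.exp_zero]
  rw [hstart, gramianForm_zero, mul_zero, zero_add, mul_add] at hlyap
  have := mul_le_mul_of_nonneg_left (hA.expConv_norm_sq_exp_smul_apply_le x ht)
    (show 0 ≤ 2 * ‖gramian A‖ ^ 2 * (4 * ε) by positivity)
  linarith

theorem gramianForm_le (hu : IsForcedPath A F x b u) (hA : ExpStable A)
    (hF : Continuous F) (hε : 0 ≤ ε)
    (hε_small : 16 * ‖gramian A‖ ^ 2 * coercivityConst A * ε ≤ decayRate A)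
    (hFK : ∀ v, ‖F v‖ ^ 2 ≤ K + ε * ‖v‖ ^ 2) {t : ℝ} (ht : 0 ≤ t) :
    gramianForm A (u t) ≤ Real.exp (-(decayRate A / 2 * t)) * gramianForm A x +
      4 * ‖gramian A‖ ^ 2 * expConv (decayRate A) (fun s => K + 2 * ε * ‖ouPath A b s‖ ^ 2) t +
      2 * inner ℝ (NormedSpace.exp (t • A) x) (gramian A (ouPath A b t)) +
      2 * gramianForm A (ouPath A b t) := by
  set z := ouPath A b t
  set S := NormedSpace.exp (t • A) x
  have hexpand : gramianForm A (u t) =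
      gramianForm A (u t - z) + 2 * inner ℝ (u t - z) (gramian A z) + gramianForm A z := by
    rw [← hA.gramianForm_add, sub_add_cancel]
  have hcross : 2 * inner ℝ (u t - z) (gramian A z) ≤
      2 * inner ℝ S (gramian A z) + gramianForm A (u t - z - S) + gramianForm A z := by
    have hsplit : inner ℝ (u t - z) (gramian A z) =
        inner ℝ S (gramian A z) + inner ℝ (u t - z - S) (gramian A z) := by
      rw [← inner_add_left, add_sub_cancel]
    linarith [hA.two_mul_inner_gramian_le (u t - z - S) z]
  have hdecay : Real.exp (-(decayRate A * t)) * (1 + decayRate A / 2 * t) ≤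
      Real.exp (-(decayRate A / 2 * t)) :=
    calc Real.exp (-(decayRate A * t)) * (1 + decayRate A / 2 * t)
        ≤ Real.exp (-(decayRate A * t)) * Real.exp (decayRate A / 2 * t) := by
          gcongr
          linarith [Real.add_one_le_exp (decayRate A / 2 * t)]
      _ = Real.exp (-(decayRate A / 2 * t)) := by
          rw [← Real.exp_add]
          ring_nf
  have hquarter := eight_mul_sq_norm_gramian_mul_le_one_fourth hε hε_small
  linarith [hu.gramianForm_sub_ouPath_le hA hF hε (by linarith) hFK ht,
    hu.gramianForm_remainder_le hA hF hε hε_small hFK ht,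
    mul_le_mul_of_nonneg_right hdecay (hA.gramianForm_nonneg x)]

end IsForcedPath

end ForcedPath

section RandomPaths

variable {Ω : Type*} [MeasurableSpace Ω] {P : Measure Ω}

theorem aestronglyMeasurable_uncurry_of_ae_continuous {ι β : Type*} [TopologicalSpace ι]
    [TopologicalSpace.MetrizableSpace ι] [SecondCountableTopology ι] [MeasurableSpace ι]
    [OpensMeasurableSpace ι] [TopologicalSpace β] [TopologicalSpace.PseudoMetrizableSpace β]
    {μ : Measure ι} {f : ι → Ω → β}
    (hf : ∀ i, AEStronglyMeasurable (f i) P) (hcont : ∀ᵐ ω ∂P, Continuous fun i => f i ω) :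
    AEStronglyMeasurable (Function.uncurry f) (μ.prod P) := by
  have hid : StronglyMeasurable (id : ι → ι) := stronglyMeasurable_id
  let g (k : ℕ) (p : ι × Ω) : β := (hf (hid.approx k p.1)).mk _ p.2
  have hg (k : ℕ) : StronglyMeasurable (g k) := by
    have hfinite := stronglyMeasurable_uncurry_of_continuous_of_stronglyMeasurable
      (u := fun i : (hid.approx k).range => (hf i).mk _) (fun _ => continuous_of_discreteTopology)
      fun i => (hf i).stronglyMeasurable_mk
    exact hfinite.comp_measurable ((((hid.approx k).measurable.comp measurable_fst).subtype_mk
      (h := fun _ => SimpleFunc.mem_range_self _ _)).prodMk measurable_snd)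
  have hmk : ∀ᵐ ω ∂P, ∀ k, ∀ i ∈ (hid.approx k).range, f i ω = (hf i).mk _ ω :=
    ae_all_iff.2 fun k => (Filter.eventually_all_finset _).2 fun i _ => (hf i).ae_eq_mk
  refine aestronglyMeasurable_of_tendsto_ae atTop (fun k => (hg k).aestronglyMeasurable) ?_
  filter_upwards [Measure.quasiMeasurePreserving_snd.ae (hcont.and hmk)] with p hp
  exact ((hp.1.tendsto p.1).comp (hid.tendsto_approx p.1)).congr
    fun k => hp.2 k _ (SimpleFunc.mem_range_self _ _)

theorem integrable_and_integral_le_of_ae_le {f g : Ω → ℝ} (hf : AEStronglyMeasurable f P)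
    (hf_nonneg : ∀ ω, 0 ≤ f ω) (hg : Integrable g P) (hfg : f ≤ᵐ[P] g) :
    Integrable f P ∧ ∫ ω, f ω ∂P ≤ ∫ ω, g ω ∂P :=
  have hint : Integrable f P := hg.mono' hf
    (hfg.mono fun ω hω => (Real.norm_of_nonneg (hf_nonneg ω)).trans_le hω)
  ⟨hint, integral_mono_ae hint hg hfg⟩

variable [SFinite P] {E : Type*} [NormedAddCommGroup E] {f : ℝ → Ω → E} {t : ℝ}

theorem aestronglyMeasurable_intervalIntegral_of_ae_continuous [NormedSpace ℝ E]
    (hf : ∀ s, AEStronglyMeasurable (f s) P) (hcont : ∀ᵐ ω ∂P, Continuous fun s => f s ω)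
    (a b : ℝ) : AEStronglyMeasurable (fun ω => ∫ s in a..b, f s ω) P :=
  (aestronglyMeasurable_uncurry_of_ae_continuous hf hcont).prod_swap.integral_prod_right'.sub
    (aestronglyMeasurable_uncurry_of_ae_continuous hf hcont).prod_swap.integral_prod_right'

theorem integrable_uncurry_of_integral_norm_le {β : ℝ → ℝ}
    (hf : ∀ s, AEStronglyMeasurable (f s) P) (hcont : ∀ᵐ ω ∂P, Continuous fun s => f s ω)
    (hint : ∀ s ∈ Icc 0 t, Integrable (f s) P) (hβ : Continuous β)
    (hfβ : ∀ s ∈ Icc 0 t, ∫ ω, ‖f s ω‖ ∂P ≤ β s) :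
    Integrable (Function.uncurry f) ((volume.restrict (Ioc 0 t)).prod P) := by
  have hmeas := aestronglyMeasurable_uncurry_of_ae_continuous
    (μ := volume.restrict (Ioc 0 t)) hf hcont
  have hIoc : ∀ᵐ s ∂volume.restrict (Ioc 0 t), s ∈ Icc 0 t :=
    (ae_restrict_mem measurableSet_Ioc).mono fun _ hs => Ioc_subset_Icc_self hs
  refine (integrable_prod_iff hmeas).2 ⟨hIoc.mono hint, Integrable.mono' (g := β)
    (hβ.integrableOn_Icc.mono_set Ioc_subset_Icc_self) hmeas.norm.integral_prod_right'
    (hIoc.mono fun s hs => ?_)⟩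
  rw [Real.norm_of_nonneg (integral_nonneg fun _ => norm_nonneg _)]
  exact hfβ s hs

section ExpConv

variable {c : ℝ} {h : ℝ → Ω → ℝ} {β : ℝ → ℝ}

theorem integrable_uncurry_exp_mul (hh : ∀ s, AEStronglyMeasurable (h s) P)
    (hcont : ∀ᵐ ω ∂P, Continuous fun s => h s ω) (hh_nonneg : ∀ s ω, 0 ≤ h s ω)
    (hint : ∀ s ∈ Icc 0 t, Integrable (h s) P) (hβ : Continuous β)
    (hhβ : ∀ s ∈ Icc 0 t, ∫ ω, h s ω ∂P ≤ β s) :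
    Integrable (Function.uncurry fun s ω => Real.exp (-(c * (t - s))) * h s ω)
      ((volume.restrict (Ioc 0 t)).prod P) := by
  refine integrable_uncurry_of_integral_norm_le (β := fun s => Real.exp (-(c * (t - s))) * β s)
    (fun s => (hh s).const_mul _) (hcont.mono fun ω hω => by fun_prop)
    (fun s hs => (hint s hs).const_mul _) (by fun_prop) fun s hs => ?_
  simp only [norm_mul, Real.norm_of_nonneg (hh_nonneg s _), Real.norm_of_nonneg (Real.exp_nonneg _)]
  rw [integral_const_mul]
  exact mul_le_mul_of_nonneg_left (hhβ s hs) (Real.exp_nonneg _)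

theorem integrable_expConv (ht : 0 ≤ t) (hh : ∀ s, AEStronglyMeasurable (h s) P)
    (hcont : ∀ᵐ ω ∂P, Continuous fun s => h s ω) (hh_nonneg : ∀ s ω, 0 ≤ h s ω)
    (hint : ∀ s ∈ Icc 0 t, Integrable (h s) P) (hβ : Continuous β)
    (hhβ : ∀ s ∈ Icc 0 t, ∫ ω, h s ω ∂P ≤ β s) :
    Integrable (fun ω => expConv c (fun s => h s ω) t) P := by
  simp only [expConv, intervalIntegral.integral_of_le ht]
  exact (integrable_uncurry_exp_mul hh hcont hh_nonneg hint hβ hhβ).integral_prod_right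

theorem integral_expConv_le (ht : 0 ≤ t) (hh : ∀ s, AEStronglyMeasurable (h s) P)
    (hcont : ∀ᵐ ω ∂P, Continuous fun s => h s ω) (hh_nonneg : ∀ s ω, 0 ≤ h s ω)
    (hint : ∀ s ∈ Icc 0 t, Integrable (h s) P) (hβ : Continuous β)
    (hhβ : ∀ s ∈ Icc 0 t, ∫ ω, h s ω ∂P ≤ β s) :
    ∫ ω, expConv c (fun s => h s ω) t ∂P ≤ expConv c β t := by
  have hprod := integrable_uncurry_exp_mul (c := c) hh hcont hh_nonneg hint hβ hhβ
  simp only [expConv, intervalIntegral.integral_of_le ht]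
  rw [← integral_integral_swap hprod]
  refine setIntegral_mono_on hprod.integral_prod_left
    (Continuous.integrableOn_Ioc (by fun_prop)) measurableSet_Ioc fun s hs => ?_
  rw [integral_const_mul]
  exact mul_le_mul_of_nonneg_left (hhβ s (Ioc_subset_Icc_self hs)) (Real.exp_nonneg _)

end ExpConv

end RandomPaths

section Noise

variable {Ω : Type*} [MeasurableSpace Ω]

/-- A centered square-integrable process with continuous paths, started at zero, whose increments
have variance at most `σ (t - s)`: all that the moment bounds use of `B W`. -/
structure IsDiffusiveNoise {E : Type*} [NormedAddCommGroup E] [NormedSpace ℝ E]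
    (b : ℝ → Ω → E) (P : Measure Ω) (σ : ℝ≥0) : Prop where
  memLp : ∀ t, MemLp (b t) 2 P
  ae_continuous : ∀ᵐ ω ∂P, Continuous fun t => b t ω
  ae_zero : ∀ᵐ ω ∂P, b 0 ω = 0
  mean : ∀ t, ∫ ω, b t ω ∂P = 0
  integral_sq_le : ∀ ⦃s t⦄, 0 ≤ s → s ≤ t → ∫ ω, ‖b s ω - b t ω‖ ^ 2 ∂P ≤ σ * (t - s)

/-- A bound for the second moments of the Ornstein-Uhlenbeck process driven by a noise whose
increments have variance at most `σ (t - s)`. -/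
noncomputable def ouMomentBound {E : Type*} [NormedAddCommGroup E] [InnerProductSpace ℝ E]
    [CompleteSpace E] (A : E →L[ℝ] E) (σ : ℝ≥0) : ℝ :=
  2 * coercivityConst A * (2 * ‖gramian A‖ ^ 2 * ‖A‖ ^ 2 * (σ * (1 / decayRate A ^ 2)) +
    ‖gramian A‖ * (σ * (1 / decayRate A)))

theorem ouMomentBound_nonneg {E : Type*} [NormedAddCommGroup E] [InnerProductSpace ℝ E]
    [CompleteSpace E] (A : E →L[ℝ] E) (σ : ℝ≥0) : 0 ≤ ouMomentBound A σ := by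
  have := decayRate_pos (A := A)
  have := coercivityConst_nonneg (A := A)
  unfold ouMomentBound
  positivity

namespace IsDiffusiveNoise

variable {P : Measure Ω} {σ : ℝ≥0} {t : ℝ}

section NormedSpace

variable {E : Type*} [NormedAddCommGroup E] [NormedSpace ℝ E] {A : E →L[ℝ] E} {b : ℝ → Ω → E}

theorem integral_norm_sq_le (hb : IsDiffusiveNoise b P σ) (ht : 0 ≤ t) :
    ∫ ω, ‖b t ω‖ ^ 2 ∂P ≤ σ * t := by
  have hincrement : (fun ω => ‖b 0 ω - b t ω‖ ^ 2) =ᵐ[P] fun ω => ‖b t ω‖ ^ 2 := by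
    filter_upwards [hb.ae_zero] with ω hω
    rw [hω, zero_sub, norm_neg]
  simpa [integral_congr_ae hincrement] using hb.integral_sq_le le_rfl ht

theorem integrable_norm_sq (hb : IsDiffusiveNoise b P σ) (t : ℝ) :
    Integrable (fun ω => ‖b t ω‖ ^ 2) P :=
  (hb.memLp t).integrable_norm_pow two_ne_zero

theorem integrable_norm_sub_sq (hb : IsDiffusiveNoise b P σ) (s t : ℝ) :
    Integrable (fun ω => ‖b s ω - b t ω‖ ^ 2) P :=
  ((hb.memLp s).sub (hb.memLp t)).integrable_norm_pow two_ne_zero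

theorem integral_norm_le [IsProbabilityMeasure P] (hb : IsDiffusiveNoise b P σ) (ht : 0 ≤ t) :
    ∫ ω, ‖b t ω‖ ∂P ≤ 1 + σ * t :=
  calc ∫ ω, ‖b t ω‖ ∂P ≤ ∫ ω, (1 + ‖b t ω‖ ^ 2) ∂P := by
        refine integral_mono ((hb.memLp t).integrable one_le_two).norm
          ((integrable_const 1).add (hb.integrable_norm_sq t)) fun ω => ?_
        change ‖b t ω‖ ≤ 1 + ‖b t ω‖ ^ 2
        linarith [two_mul_le_add_sq 1 ‖b t ω‖, norm_nonneg (b t ω)]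
    _ = 1 + ∫ ω, ‖b t ω‖ ^ 2 ∂P := by
        rw [integral_add (integrable_const 1) (hb.integrable_norm_sq t)]
        simp
    _ ≤ 1 + σ * t := by gcongr; exact hb.integral_norm_sq_le ht

section Increment

variable [SFinite P]

theorem integrable_expConv_norm_sub_sq (hb : IsDiffusiveNoise b P σ) (c : ℝ) (ht : 0 ≤ t) :
    Integrable (fun ω => expConv c (fun s => ‖b s ω - b t ω‖ ^ 2) t) P :=
  integrable_expConv ht (fun s => (hb.integrable_norm_sub_sq s t).aestronglyMeasurable)
    (hb.ae_continuous.mono fun ω hω => by fun_prop) (fun _ _ => by positivity)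
    (fun s _ => hb.integrable_norm_sub_sq s t) (β := fun s => σ * (t - s)) (by fun_prop)
    fun _ hs => hb.integral_sq_le hs.1 hs.2

theorem integral_expConv_norm_sub_sq_le (hb : IsDiffusiveNoise b P σ) {c : ℝ} (hc : 0 < c)
    (ht : 0 ≤ t) :
    ∫ ω, expConv c (fun s => ‖b s ω - b t ω‖ ^ 2) t ∂P ≤ σ * (1 / c ^ 2) :=
  calc ∫ ω, expConv c (fun s => ‖b s ω - b t ω‖ ^ 2) t ∂P
      ≤ expConv c (fun s => σ * (t - s)) t :=
        integral_expConv_le ht (fun s => (hb.integrable_norm_sub_sq s t).aestronglyMeasurable)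
          (hb.ae_continuous.mono fun ω hω => by fun_prop) (fun _ _ => by positivity)
          (fun s _ => hb.integrable_norm_sub_sq s t) (by fun_prop)
          fun _ hs => hb.integral_sq_le hs.1 hs.2
    _ ≤ σ * (1 / c ^ 2) := by
        rw [expConv_const_mul]
        gcongr
        exact expConv_sub_le hc ht

end Increment

theorem aestronglyMeasurable_exp_neg_smul_apply (hb : IsDiffusiveNoise b P σ) (s : ℝ) :
    AEStronglyMeasurable (fun ω => NormedSpace.exp ((-s) • A) (b s ω)) P :=
  (ContinuousLinearMap.continuous _).comp_aestronglyMeasurable (hb.memLp s).aestronglyMeasurable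

variable [CompleteSpace E]

theorem ae_continuous_exp_neg_smul_apply (hb : IsDiffusiveNoise b P σ) :
    ∀ᵐ ω ∂P, Continuous fun s : ℝ => NormedSpace.exp ((-s) • A) (b s ω) :=
  hb.ae_continuous.mono fun _ hω =>
    ((continuous_exp_smul A).comp continuous_neg).clm_apply hω

theorem aestronglyMeasurable_ouPath [SFinite P] (hb : IsDiffusiveNoise b P σ) (t : ℝ) :
    AEStronglyMeasurable (fun ω => ouPath A (fun s => b s ω) t) P :=
  (hb.memLp t).aestronglyMeasurable.add
    ((A ∘L NormedSpace.exp (t • A)).continuous.comp_aestronglyMeasurable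
      (aestronglyMeasurable_intervalIntegral_of_ae_continuous
        hb.aestronglyMeasurable_exp_neg_smul_apply hb.ae_continuous_exp_neg_smul_apply 0 t))

variable [IsProbabilityMeasure P]

theorem integrable_uncurry_exp_neg_smul_apply (hb : IsDiffusiveNoise b P σ) (t : ℝ) :
    Integrable (Function.uncurry fun s ω => NormedSpace.exp ((-s) • A) (b s ω))
      ((volume.restrict (Ioc 0 t)).prod P) := by
  have hint (s : ℝ) : Integrable (b s) P := (hb.memLp s).integrable one_le_two
  refine integrable_uncurry_of_integral_norm_le
    (β := fun s => ‖NormedSpace.exp ((-s) • A)‖ * (1 + σ * s))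
    hb.aestronglyMeasurable_exp_neg_smul_apply hb.ae_continuous_exp_neg_smul_apply
    (fun s _ => ContinuousLinearMap.integrable_comp _ (hint s))
    (((continuous_exp_smul A).comp continuous_neg).norm.mul (by fun_prop)) fun s hs => ?_
  calc ∫ ω, ‖NormedSpace.exp ((-s) • A) (b s ω)‖ ∂P
      ≤ ∫ ω, ‖NormedSpace.exp ((-s) • A)‖ * ‖b s ω‖ ∂P :=
        integral_mono (ContinuousLinearMap.integrable_comp _ (hint s)).norm
          ((hint s).norm.const_mul _) fun ω => ContinuousLinearMap.le_opNorm _ _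
    _ ≤ ‖NormedSpace.exp ((-s) • A)‖ * (1 + σ * s) := by
        rw [integral_const_mul]
        gcongr
        exact hb.integral_norm_le hs.1

theorem integrable_duhamel (hb : IsDiffusiveNoise b P σ) (ht : 0 ≤ t) :
    Integrable (fun ω => duhamel A (fun s => b s ω) t) P := by
  simp only [duhamel, intervalIntegral.integral_of_le ht]
  exact ContinuousLinearMap.integrable_comp _
    (hb.integrable_uncurry_exp_neg_smul_apply t).integral_prod_right

theorem integral_duhamel (hb : IsDiffusiveNoise b P σ) (ht : 0 ≤ t) :
    ∫ ω, duhamel A (fun s => b s ω) t ∂P = 0 := by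
  have hprod := hb.integrable_uncurry_exp_neg_smul_apply (A := A) t
  simp only [duhamel, intervalIntegral.integral_of_le ht]
  have hpath : Integrable
      (fun ω => ∫ s in Ioc 0 t, NormedSpace.exp ((-s) • A) (b s ω)) P :=
    hprod.integral_prod_right
  rw [ContinuousLinearMap.integral_comp_comm _ hpath, ← integral_integral_swap hprod]
  simp [ContinuousLinearMap.integral_comp_comm _ ((hb.memLp _).integrable one_le_two), hb.mean]

theorem integrable_ouPath (hb : IsDiffusiveNoise b P σ) (ht : 0 ≤ t) :
    Integrable (fun ω => ouPath A (fun s => b s ω) t) P :=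
  ((hb.memLp t).integrable one_le_two).add (A.integrable_comp (hb.integrable_duhamel ht))

theorem integral_ouPath (hb : IsDiffusiveNoise b P σ) (ht : 0 ≤ t) :
    ∫ ω, ouPath A (fun s => b s ω) t ∂P = 0 := by
  simp only [ouPath]
  rw [integral_add ((hb.memLp t).integrable one_le_two)
    (A.integrable_comp (hb.integrable_duhamel ht)),
    A.integral_comp_comm (hb.integrable_duhamel ht), hb.mean, hb.integral_duhamel ht, map_zero,
    add_zero]

end NormedSpace

variable {E : Type*} [NormedAddCommGroup E] [InnerProductSpace ℝ E] [CompleteSpace E]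
  {A : E →L[ℝ] E} {b : ℝ → Ω → E}

theorem integrable_and_integral_norm_sq_ouPath_le [SFinite P] (hb : IsDiffusiveNoise b P σ)
    (hA : ExpStable A) (ht : 0 ≤ t) :
    Integrable (fun ω => ‖ouPath A (fun s => b s ω) t‖ ^ 2) P ∧
      ∫ ω, ‖ouPath A (fun s => b s ω) t‖ ^ 2 ∂P ≤ ouMomentBound A σ := by
  have hbound : ∀ᵐ ω ∂P, ‖ouPath A (fun s => b s ω) t‖ ^ 2 ≤ _ :=
    hb.ae_continuous.mono fun ω hω => hA.norm_sq_ouPath_le hω ht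
  have hdelta := (hb.integrable_expConv_norm_sub_sq (decayRate A) ht).const_mul
    (2 * ‖gramian A‖ ^ 2 * ‖A‖ ^ 2)
  have hend := ((hb.integrable_norm_sq t).mul_const (Real.exp (-(decayRate A * t)))).const_mul
    ‖gramian A‖
  have hint := (hdelta.add hend).const_mul (2 * coercivityConst A)
  have hend_le : (∫ ω, ‖b t ω‖ ^ 2 ∂P) * Real.exp (-(decayRate A * t)) ≤
      σ * (1 / decayRate A) :=
    calc (∫ ω, ‖b t ω‖ ^ 2 ∂P) * Real.exp (-(decayRate A * t))
        ≤ σ * t * Real.exp (-(decayRate A * t)) := by gcongr; exact hb.integral_norm_sq_le ht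
      _ = σ * (t * Real.exp (-(decayRate A * t))) := mul_assoc _ _ _
      _ ≤ _ := by gcongr; exact mul_exp_neg_mul_le decayRate_pos t
  refine (integrable_and_integral_le_of_ae_le ((hb.aestronglyMeasurable_ouPath t).norm.pow 2)
    (fun _ => sq_nonneg _) hint hbound).imp_right fun hle => hle.trans ?_
  simp only [Pi.add_apply]
  rw [integral_const_mul, integral_add hdelta hend, integral_const_mul, integral_const_mul,
    integral_mul_const, ouMomentBound]
  gcongr
  · exact mul_nonneg zero_le_two coercivityConst_nonneg
  · exact hb.integral_expConv_norm_sub_sq_le decayRate_pos ht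

end IsDiffusiveNoise

end Noise

section MomentBound

variable {Ω : Type*} [MeasurableSpace Ω] {P : Measure Ω} [IsProbabilityMeasure P] {E : Type*}
  [NormedAddCommGroup E] [InnerProductSpace ℝ E] [CompleteSpace E] {A : E →L[ℝ] E}
  {b : ℝ → Ω → E} {σ : ℝ≥0} {K ε t : ℝ}

namespace IsDiffusiveNoise

theorem integrable_and_integral_expConv_ouPath_le (hb : IsDiffusiveNoise b P σ)
    (hA : ExpStable A) (hK : 0 ≤ K) (hε : 0 ≤ ε) {c : ℝ} (hc : 0 < c) (ht : 0 ≤ t) :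
    Integrable (fun ω =>
        expConv c (fun s => K + ε * ‖ouPath A (fun r => b r ω) s‖ ^ 2) t) P ∧
      ∫ ω, expConv c (fun s => K + ε * ‖ouPath A (fun r => b r ω) s‖ ^ 2) t ∂P ≤
        (K + ε * ouMomentBound A σ) * (1 / c) := by
  have hmoment := fun s (hs : s ∈ Icc 0 t) => hb.integrable_and_integral_norm_sq_ouPath_le hA hs.1
  have hmeas (s : ℝ) : AEStronglyMeasurable
      (fun ω => K + ε * ‖ouPath A (fun r => b r ω) s‖ ^ 2) P :=
    (((hb.aestronglyMeasurable_ouPath s).norm.pow 2).const_mul ε).const_add K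
  have hcont : ∀ᵐ ω ∂P, Continuous fun s => K + ε * ‖ouPath A (fun r => b r ω) s‖ ^ 2 := by
    filter_upwards [hb.ae_continuous] with ω hω
    have := continuous_ouPath A hω
    fun_prop
  have hnonneg (s : ℝ) (ω : Ω) : 0 ≤ K + ε * ‖ouPath A (fun r => b r ω) s‖ ^ 2 := by positivity
  have hint : ∀ s ∈ Icc 0 t,
      Integrable (fun ω => K + ε * ‖ouPath A (fun r => b r ω) s‖ ^ 2) P :=
    fun s hs => (integrable_const K).add ((hmoment s hs).1.const_mul ε)
  have hle : ∀ s ∈ Icc 0 t, ∫ ω, (K + ε * ‖ouPath A (fun r => b r ω) s‖ ^ 2) ∂P ≤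
      (K + ε * ouMomentBound A σ) * 1 := by
    intro s hs
    rw [integral_add (integrable_const K) ((hmoment s hs).1.const_mul ε), integral_const_mul,
      integral_const, probReal_univ, one_smul, mul_one]
    gcongr
    exact (hmoment s hs).2
  refine ⟨integrable_expConv ht hmeas hcont hnonneg hint continuous_const hle,
    (integral_expConv_le ht hmeas hcont hnonneg hint continuous_const hle).trans ?_⟩
  rw [expConv_const_mul]
  have := ouMomentBound_nonneg A σ
  gcongr
  exact expConv_one_le hc t

theorem integrable_inner_gramian_ouPath (hb : IsDiffusiveNoise b P σ) (ht : 0 ≤ t) (x : E) :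
    Integrable (fun ω => inner ℝ x (gramian A (ouPath A (fun s => b s ω) t))) P :=
  ((innerSL ℝ x) ∘L gramian A).integrable_comp (hb.integrable_ouPath ht)

theorem integral_inner_gramian_ouPath (hb : IsDiffusiveNoise b P σ) (ht : 0 ≤ t) (x : E) :
    ∫ ω, inner ℝ x (gramian A (ouPath A (fun s => b s ω) t)) ∂P = 0 := by
  have := ((innerSL ℝ x) ∘L gramian A).integral_comp_comm (hb.integrable_ouPath (A := A) ht)
  rw [hb.integral_ouPath ht, map_zero] at this
  exact this

theorem integrable_and_integral_gramianForm_ouPath_le (hb : IsDiffusiveNoise b P σ)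
    (hA : ExpStable A) (ht : 0 ≤ t) :
    Integrable (fun ω => gramianForm A (ouPath A (fun s => b s ω) t)) P ∧
      ∫ ω, gramianForm A (ouPath A (fun s => b s ω) t) ∂P ≤ ‖gramian A‖ * ouMomentBound A σ := by
  obtain ⟨hint, hle⟩ := hb.integrable_and_integral_norm_sq_ouPath_le hA ht
  refine (integrable_and_integral_le_of_ae_le
    (continuous_gramianForm.comp_aestronglyMeasurable (hb.aestronglyMeasurable_ouPath t))
    (fun _ => hA.gramianForm_nonneg _) (hint.const_mul ‖gramian A‖)
    (Eventually.of_forall fun _ => gramianForm_le _)).imp_right fun hle' => hle'.trans ?_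
  rw [integral_const_mul]
  gcongr

theorem integrable_and_integral_gramianForm_le (hb : IsDiffusiveNoise b P σ) (hA : ExpStable A)
    {F : E → E} (hF : Continuous F) (hε : 0 ≤ ε)
    (hε_small : 16 * ‖gramian A‖ ^ 2 * coercivityConst A * ε ≤ decayRate A)
    (hFK : ∀ v, ‖F v‖ ^ 2 ≤ K + ε * ‖v‖ ^ 2) {x : E} {u : ℝ → Ω → E}
    (hu : ∀ᵐ ω ∂P, IsForcedPath A F x (fun s => b s ω) fun s => u s ω)
    (hu_meas : AEStronglyMeasurable (u t) P) (ht : 0 ≤ t) :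
    Integrable (fun ω => gramianForm A (u t ω)) P ∧
      ∫ ω, gramianForm A (u t ω) ∂P ≤ Real.exp (-(decayRate A / 2 * t)) * gramianForm A x +
        4 * ‖gramian A‖ ^ 2 * ((K + 2 * ε * ouMomentBound A σ) * (1 / decayRate A)) +
        2 * (‖gramian A‖ * ouMomentBound A σ) := by
  have hK : 0 ≤ K := by simpa using (sq_nonneg _).trans (hFK 0)
  obtain ⟨hforce, hforce_le⟩ := hb.integrable_and_integral_expConv_ouPath_le hA hK
    (mul_nonneg zero_le_two hε) (decayRate_pos (A := A)) ht
  obtain ⟨hnoise, hnoise_le⟩ := hb.integrable_and_integral_gramianForm_ouPath_le hA ht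
  have hcross := hb.integrable_inner_gramian_ouPath (A := A) ht (NormedSpace.exp (t • A) x)
  have hsum₁ := (integrable_const (Real.exp (-(decayRate A / 2 * t)) * gramianForm A x)).add
    (hforce.const_mul (4 * ‖gramian A‖ ^ 2))
  have hsum₂ := hsum₁.add (hcross.const_mul 2)
  refine (integrable_and_integral_le_of_ae_le
    (continuous_gramianForm.comp_aestronglyMeasurable hu_meas)
    (fun _ => hA.gramianForm_nonneg _) (hsum₂.add (hnoise.const_mul 2))
    (hu.mono fun ω hω => hω.gramianForm_le hA hF hε hε_small hFK ht)).imp_right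
    fun hle => hle.trans ?_
  rw [integral_add' hsum₂ (hnoise.const_mul 2), integral_add' hsum₁ (hcross.const_mul 2),
    integral_add' (integrable_const _) (hforce.const_mul _), integral_const, probReal_univ,
    one_smul, integral_const_mul, integral_const_mul, integral_const_mul,
    hb.integral_inner_gramian_ouPath ht, mul_zero, add_zero]
  gcongr

end IsDiffusiveNoise

end MomentBound

section Wiener

theorem integral_norm_sq_multivariateGaussian_zero {ι : Type*} [Fintype ι] [DecidableEq ι]
    {S : Matrix ι ι ℝ} (hS : S.PosSemidef) :
    ∫ x, ‖x‖ ^ 2 ∂(multivariateGaussian (0 : EuclideanSpace ℝ ι) S) = S.trace := by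
  set μ := multivariateGaussian (0 : EuclideanSpace ℝ ι) S
  have hcoord (i : ι) : MemLp (fun x : EuclideanSpace ℝ ι => x i) 2 μ :=
    (EuclideanSpace.proj (𝕜 := ℝ) i).comp_memLp' IsGaussian.memLp_two_id
  have hmean (i : ι) : ∫ x : EuclideanSpace ℝ ι, x i ∂μ = 0 := by
    have := (EuclideanSpace.proj (𝕜 := ℝ) i).integral_comp_comm (μ := μ) IsGaussian.integrable_id
    simpa [μ] using this
  simp_rw [EuclideanSpace.real_norm_sq_eq]
  rw [integral_finsetSum _ fun i _ => (hcoord i).integrable_sq]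
  refine Finset.sum_congr rfl fun i _ => ?_
  rw [← variance_of_integral_eq_zero (hcoord i).aemeasurable (hmean i),
    variance_eval_multivariateGaussian hS, Matrix.diag_apply]

namespace IsWienerProcess

variable {n : ℕ} {Ω : Type*} [MeasurableSpace Ω] {P : Measure Ω}
  {W : ℝ≥0 → Ω → EuclideanSpace ℝ (Fin n)}

theorem hasLaw (hW : IsWienerProcess W P) (t : ℝ≥0) :
    HasLaw (W t) (multivariateGaussian 0 ((t : ℝ) • (1 : Matrix (Fin n) (Fin n) ℝ))) P := by
  have hincrement := hW.law 0 t zero_le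
  rw [NNReal.coe_zero, sub_zero] at hincrement
  exact hincrement.congr (hW.zero.mono fun ω hω => by simp [hω])

theorem memLp (hW : IsWienerProcess W P) (t : ℝ≥0) : MemLp (W t) 2 P := by
  have hid := IsGaussian.memLp_two_id
    (μ := multivariateGaussian 0 ((t : ℝ) • (1 : Matrix (Fin n) (Fin n) ℝ)))
  rw [← (hW.hasLaw t).map_eq] at hid
  exact hid.comp_of_map (hW.hasLaw t).aemeasurable

theorem integral_eq_zero (hW : IsWienerProcess W P) (t : ℝ≥0) : ∫ ω, W t ω ∂P = 0 :=
  (hW.hasLaw t).integral_eq.trans integral_id_multivariateGaussian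

theorem integral_norm_sub_sq (hW : IsWienerProcess W P) {s t : ℝ≥0} (hst : s ≤ t) :
    ∫ ω, ‖W t ω - W s ω‖ ^ 2 ∂P = n * ((t : ℝ) - s) := by
  have hlaw := hW.law s t hst
  have hvariance := integral_norm_sq_multivariateGaussian_zero
    (Matrix.PosSemidef.one (n := Fin n) (R := ℝ).smul (sub_nonneg.2 (NNReal.coe_le_coe.2 hst)))
  rw [← hlaw.integral_comp (by fun_prop)] at hvariance
  simpa [mul_comm] using hvariance

theorem isDiffusiveNoise [IsProbabilityMeasure P] (hW : IsWienerProcess W P) {E : Type*}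
    [NormedAddCommGroup E] [NormedSpace ℝ E] [CompleteSpace E]
    (B : EuclideanSpace ℝ (Fin n) →L[ℝ] E) :
    IsDiffusiveNoise (fun t ω => B (W t.toNNReal ω)) P (‖B‖₊ ^ 2 * n) where
  memLp t := B.comp_memLp' (hW.memLp _)
  ae_continuous := hW.cont.mono fun ω hω =>
    B.continuous.comp (hω.comp continuous_real_toNNReal)
  ae_zero := hW.zero.mono fun ω hω => by simp [hω]
  mean t := by
    rw [B.integral_comp_comm ((hW.memLp _).integrable one_le_two), hW.integral_eq_zero, map_zero]
  integral_sq_le s t hs hst := by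
    have hmono := Real.toNNReal_le_toNNReal hst
    have hint : Integrable (fun ω => ‖W t.toNNReal ω - W s.toNNReal ω‖ ^ 2) P :=
      ((hW.memLp _).sub (hW.memLp _)).integrable_norm_pow two_ne_zero
    calc ∫ ω, ‖B (W s.toNNReal ω) - B (W t.toNNReal ω)‖ ^ 2 ∂P
        ≤ ∫ ω, ‖B‖ ^ 2 * ‖W t.toNNReal ω - W s.toNNReal ω‖ ^ 2 ∂P := by
          refine integral_mono_of_nonneg (Eventually.of_forall fun _ => sq_nonneg _)
            (hint.const_mul _) (Eventually.of_forall fun ω => ?_)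
          change ‖B (W s.toNNReal ω) - B (W t.toNNReal ω)‖ ^ 2 ≤
            ‖B‖ ^ 2 * ‖W t.toNNReal ω - W s.toNNReal ω‖ ^ 2
          rw [norm_sub_rev, ← map_sub, ← mul_pow]
          gcongr
          exact B.le_opNorm _
      _ = (‖B‖₊ ^ 2 * n : ℝ≥0) * (t - s) := by
          rw [integral_const_mul, hW.integral_norm_sub_sq hmono, Real.coe_toNNReal s hs,
            Real.coe_toNNReal t (hs.trans hst), ← mul_assoc]
          push_cast
          rfl

end IsWienerProcess

end Wiener

section Growth

theorem exists_norm_sq_le_of_isLittleO {E : Type*} [NormedAddCommGroup E] [ProperSpace E]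
    {F : E → E} (hF : Continuous F) (hF_small : F =o[Bornology.cobounded E] id) {ε : ℝ}
    (hε : 0 < ε) : ∃ K, ∀ v, ‖F v‖ ^ 2 ≤ K + ε * ‖v‖ ^ 2 := by
  have hfar := hF_small.def (Real.sqrt_pos.2 hε)
  rw [Metric.cobounded_eq_cocompact, (hasBasis_cocompact).eventually_iff] at hfar
  obtain ⟨C, hC, hfar⟩ := hfar
  obtain ⟨K, hK⟩ := hC.exists_bound_of_continuousOn hF.continuousOn
  refine ⟨K ^ 2, fun v => ?_⟩
  by_cases hv : v ∈ C
  · have := pow_le_pow_left₀ (norm_nonneg _) (hK v hv) 2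
    have : 0 ≤ ε * ‖v‖ ^ 2 := by positivity
    linarith
  · have := pow_le_pow_left₀ (norm_nonneg _) (hfar hv) 2
    rw [mul_pow, Real.sq_sqrt hε.le, id] at this
    linarith [sq_nonneg K]

theorem GrowthCondition.isLittleO {d dstar : ℕ}
    {F : EuclideanSpace ℝ (Fin d) → EuclideanSpace ℝ (Fin d)} (hG : GrowthCondition dstar F)
    (hdstar : 1 ≤ dstar) : F =o[Bornology.cobounded _] id := by
  obtain ⟨a, -, ha, C, hC⟩ := hG
  have ha_lt : a < 1 := by
    refine ha.trans_le ?_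
    have : (1 : ℝ) ≤ dstar := mod_cast hdstar
    rw [div_le_one (by positivity)]
    linarith
  have hnorm : Tendsto (fun x : EuclideanSpace ℝ (Fin d) => 1 + ‖x‖)
      (Bornology.cobounded _) atTop :=
    tendsto_atTop_add_const_left _ _ tendsto_norm_cobounded_atTop
  have hbig : F =O[Bornology.cobounded _] fun x => (1 + ‖x‖) ^ a := by
    refine Asymptotics.IsBigO.of_bound C (Eventually.of_forall fun x => ?_)
    have hpos : 0 < (1 + ‖x‖) ^ a := by positivity
    rw [Real.norm_of_nonneg hpos.le]
    exact (div_le_iff₀ hpos).1 (hC ⟨x, rfl⟩)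
  have hpow : (fun x : EuclideanSpace ℝ (Fin d) => (1 + ‖x‖) ^ a) =o[Bornology.cobounded _]
      fun x => 1 + ‖x‖ := by
    refine Asymptotics.isLittleO_of_tendsto
      (fun x hx => absurd hx (by positivity)) ?_
    refine ((tendsto_rpow_neg_atTop (sub_pos.2 ha_lt)).comp hnorm).congr fun x => ?_
    rw [Function.comp_apply, neg_sub, Real.rpow_sub_one (by positivity)]
  have hone : (fun x : EuclideanSpace ℝ (Fin d) => 1 + ‖x‖) =O[Bornology.cobounded _] id := by
    refine Asymptotics.IsBigO.of_bound 2 ?_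
    filter_upwards [tendsto_norm_cobounded_atTop.eventually_ge_atTop 1] with x hx
    rw [Real.norm_of_nonneg (by positivity), id]
    linarith
  exact (hbig.trans_isLittleO hpow).trans_isBigO hone

end Growth

section SDE

variable {d n : ℕ} {A : EuclideanSpace ℝ (Fin d) →L[ℝ] EuclideanSpace ℝ (Fin d)}

theorem ExpStable.lyapunovV_eq_gramianForm (hA : ExpStable A) : lyapunovV A = gramianForm A :=
  funext fun x => (hA.gramianForm_eq_integral x).symm

theorem ExpStable.exists_posDef (hA : ExpStable A) :
    ∃ M : Matrix (Fin d) (Fin d) ℝ, M.PosDef ∧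
      ∀ x, lyapunovV A x = inner ℝ x (Matrix.toEuclideanCLM (𝕜 := ℝ) M x) := by
  obtain ⟨M, hM⟩ : ∃ M, Matrix.toEuclideanCLM (n := Fin d) (𝕜 := ℝ) M = gramian A :=
    ⟨_, (Matrix.toEuclideanCLM (n := Fin d) (𝕜 := ℝ)).apply_symm_apply _⟩
  refine ⟨M, Matrix.PosDef.of_dotProduct_mulVec_pos ?_ fun v hv => ?_, fun x => ?_⟩
  · have hentry (i j : Fin d) : M i j = inner ℝ (EuclideanSpace.single i (1 : ℝ))
        (gramian A (EuclideanSpace.single j 1)) := by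
      rw [← hM, Matrix.inner_toEuclideanCLM]
      simp
    ext i j
    rw [Matrix.conjTranspose_apply, star_trivial, hentry, hentry, hA.inner_gramian_comm]
  · have hle := hA.norm_sq_le_gramianForm (WithLp.toLp 2 v)
    rw [gramianForm, ← hM, Matrix.inner_toEuclideanCLM] at hle
    have hpos : 0 < ‖(WithLp.toLp 2 v : EuclideanSpace ℝ (Fin d))‖ ^ 2 :=
      pow_pos (norm_pos_iff.2 (by simpa using hv)) 2
    simpa using pos_of_mul_pos_right (hpos.trans_le hle) coercivityConst_nonneg
  · rw [hA.lyapunovV_eq_gramianForm, gramianForm, hM]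

theorem IsSDESolution.ae_isForcedPath {Ω : Type*} [MeasurableSpace Ω] {P : Measure Ω}
    {F : EuclideanSpace ℝ (Fin d) → EuclideanSpace ℝ (Fin d)}
    {B : EuclideanSpace ℝ (Fin n) →L[ℝ] EuclideanSpace ℝ (Fin d)}
    {W : ℝ≥0 → Ω → EuclideanSpace ℝ (Fin n)} {x : EuclideanSpace ℝ (Fin d)}
    {X : ℝ≥0 → Ω → EuclideanSpace ℝ (Fin d)} (hX : IsSDESolution A F B P W x X)
    (hW : IsWienerProcess W P) :
    ∀ᵐ ω ∂P, IsForcedPath A F x (fun s => B (W s.toNNReal ω)) fun s => X s.toNNReal ω := by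
  filter_upwards [hW.cont, hX.cont, hX.eqn] with ω hWcont hcont heqn
  refine ⟨B.continuous.comp (hWcont.comp continuous_real_toNNReal),
    hcont.comp continuous_real_toNNReal, fun t ht => ?_⟩
  simpa only [Real.coe_toNNReal t ht] using heqn t.toNNReal

theorem ExpStable.exists_integral_gramianForm_le (hA : ExpStable A)
    (B : EuclideanSpace ℝ (Fin n) →L[ℝ] EuclideanSpace ℝ (Fin d))
    {F : EuclideanSpace ℝ (Fin d) → EuclideanSpace ℝ (Fin d)} (hF : Continuous F)
    (hF_small : F =o[Bornology.cobounded _] id) :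
    ∃ K, 0 < K ∧ ∀ (Ω : Type*) [MeasurableSpace Ω] (P : Measure Ω) [IsProbabilityMeasure P]
      (W : ℝ≥0 → Ω → EuclideanSpace ℝ (Fin n)), IsWienerProcess W P →
      ∀ (x : EuclideanSpace ℝ (Fin d)) (X : ℝ≥0 → Ω → EuclideanSpace ℝ (Fin d)),
        IsSDESolution A F B P W x X →
      ∀ t : ℝ≥0, Integrable (fun ω => gramianForm A (X t ω)) P ∧
        ∫ ω, gramianForm A (X t ω) ∂P ≤
          Real.exp (-(decayRate A / 2 * t)) * gramianForm A x + K := by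
  set k := 16 * ‖gramian A‖ ^ 2 * coercivityConst A
  have hk : 0 ≤ k := mul_nonneg (by positivity) coercivityConst_nonneg
  set ε := decayRate A / (k + 1)
  have hε : 0 < ε := div_pos decayRate_pos (by linarith)
  have hε_small : k * ε ≤ decayRate A := by
    have : (k + 1) * ε = decayRate A := mul_div_cancel₀ _ (by linarith)
    linarith
  obtain ⟨K, hK⟩ := exists_norm_sq_le_of_isLittleO hF hF_small hε
  set σ := ‖B‖₊ ^ 2 * n
  set C := 4 * ‖gramian A‖ ^ 2 * ((K + 2 * ε * ouMomentBound A σ) * (1 / decayRate A)) +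
    2 * (‖gramian A‖ * ouMomentBound A σ)
  refine ⟨|C| + 1, by positivity, fun Ω _ P _ W hW x X hX t => ?_⟩
  have hmoment := (hW.isDiffusiveNoise B).integrable_and_integral_gramianForm_le hA hF hε.le
    hε_small hK (hX.ae_isForcedPath hW) (hX.aemeasurable _).aestronglyMeasurable t.coe_nonneg
  simp only [Real.toNNReal_coe] at hmoment
  exact ⟨hmoment.1, hmoment.2.trans (by linarith [le_abs_self C])⟩

end SDE

theorem mainTheorem6_general {d n : ℕ}
    {A : EuclideanSpace ℝ (Fin d) →L[ℝ] EuclideanSpace ℝ (Fin d)}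
    (B : EuclideanSpace ℝ (Fin n) →L[ℝ] EuclideanSpace ℝ (Fin d))
    {F : EuclideanSpace ℝ (Fin d) → EuclideanSpace ℝ (Fin d)}
    (hD : Dissipative A) (hF : Continuous F) (hF_small : F =o[Bornology.cobounded _] id) :
    (∀ x : EuclideanSpace ℝ (Fin d),
      IntegrableOn (fun s : ℝ => ‖(NormedSpace.exp (s • A)) x‖ ^ 2) (Ioi 0)) ∧
    (∃ M : Matrix (Fin d) (Fin d) ℝ, M.PosDef ∧
      ∀ x, lyapunovV A x = inner ℝ x (Matrix.toEuclideanCLM (𝕜 := ℝ) M x)) ∧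
    ∃ K γ : ℝ, 0 < K ∧ 0 < γ ∧ γ < 1 ∧
      ∀ (Ω : Type*) [MeasurableSpace Ω] (P : Measure Ω) [IsProbabilityMeasure P]
        (W : ℝ≥0 → Ω → EuclideanSpace ℝ (Fin n)), IsWienerProcess W P →
      ∀ (x : EuclideanSpace ℝ (Fin d)) (X : ℝ≥0 → Ω → EuclideanSpace ℝ (Fin d)),
        IsSDESolution A F B P W x X →
      ∀ t : ℝ≥0,
        Integrable (lyapunovV A) (P.map (X t)) ∧
        |∫ y, lyapunovV A y ∂(P.map (X t))| ≤ γ ^ (t : ℝ) * lyapunovV A x + K := by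
  have hA := hD.expStable
  obtain ⟨K, hK, hmoment⟩ := hA.exists_integral_gramianForm_le B hF hF_small
  have hγ : Real.exp (-(decayRate A / 2)) < 1 :=
    Real.exp_lt_one_iff.2 (neg_neg_of_pos (half_pos decayRate_pos))
  refine ⟨fun x => ?_, hA.exists_posDef, K, Real.exp (-(decayRate A / 2)), hK, Real.exp_pos _, hγ,
    fun Ω _ P _ W hW x X hX t => ?_⟩
  · simpa only [real_inner_self_eq_norm_sq] using hA.integrableOn_inner_exp_apply x x
  have hmeas := continuous_gramianForm (A := A).aestronglyMeasurable (μ := P.map (X t))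
  rw [hA.lyapunovV_eq_gramianForm, integrable_map_measure hmeas (hX.aemeasurable t),
    integral_map (hX.aemeasurable t) hmeas,
    abs_of_nonneg (integral_nonneg fun ω => hA.gramianForm_nonneg _), ← Real.exp_mul, neg_mul]
  exact hmoment Ω P W hW x X hX t

theorem mainTheorem6 (d n : ℕ) (hn : 1 ≤ n) (hnd : n ≤ d)
    (A : EuclideanSpace ℝ (Fin d) →L[ℝ] EuclideanSpace ℝ (Fin d))
    (B : EuclideanSpace ℝ (Fin n) →L[ℝ] EuclideanSpace ℝ (Fin d))
    (F : EuclideanSpace ℝ (Fin d) → EuclideanSpace ℝ (Fin d))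
    (hF_smooth : ContDiff ℝ ((⊤ : ℕ∞) : WithTop ℕ∞) F) (hF_lip : ∃ L : ℝ≥0, LipschitzWith L F)
    (dstar : ℕ) (hdstar : 1 ≤ dstar) (hdstar_le : dstar ≤ d)
    (hD : Dissipative A) (hG : GrowthCondition dstar F) :
    (∀ x : EuclideanSpace ℝ (Fin d),
      IntegrableOn (fun s : ℝ => ‖(NormedSpace.exp (s • A)) x‖ ^ 2) (Set.Ioi 0)) ∧
    (∃ M : Matrix (Fin d) (Fin d) ℝ, M.PosDef ∧
      ∀ x, lyapunovV A x = inner ℝ x (Matrix.toEuclideanCLM (𝕜 := ℝ) M x)) ∧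
    ∃ K γ : ℝ, 0 < K ∧ 0 < γ ∧ γ < 1 ∧
      ∀ (Ω : Type*) [MeasurableSpace Ω] (P : Measure Ω) [IsProbabilityMeasure P]
        (W : ℝ≥0 → Ω → EuclideanSpace ℝ (Fin n)), IsWienerProcess W P →
      ∀ (x : EuclideanSpace ℝ (Fin d)) (X : ℝ≥0 → Ω → EuclideanSpace ℝ (Fin d)),
        IsSDESolution A F B P W x X →
      ∀ t : ℝ≥0,
        Integrable (lyapunovV A) (P.map (X t)) ∧
        |∫ y, lyapunovV A y ∂(P.map (X t))| ≤ γ ^ (t : ℝ) * lyapunovV A x + K :=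
  mainTheorem6_general B hD hF_smooth.continuous (hG.isLittleO hdstar)
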